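/- Let $\mathbb{C}((1/z))$ be the field of formal Laurent series with finitely many positive powers of $z$. Let $\Sigma_3$ be the set of subspaces $V\subset\mathbb{C}((1/z))$ with $z^2V\subset V$ whose nonzero elements have exactly the orders (degrees of the leading power of $z$) $-3,-1,1,3,4,5,\dots$. Let $W_3$ be the set of all subspaces $W\subset\mathbb{C}((1/z))$ spanned by series $$p_j(z)=z^j+H^j_{-2}z^2+H^j_0+\sum_{k\ge1}H^j_kz^{-k},\qquad j=3,4,5,\dots,$$ such that $z^2W\subset W$ and $W\cdot W\subset W$. (1) Every $W\in W_3$ is contained in some $V\in\Sigma_3$. The elements of $W_3$ are exactly the spaces spanned by the polynomials $p_j=z^j+H^j_{-2}z^2+H^j_0$ $(j\ge3)$, where the coefficients satisfy, for all $j\ge5$, $$H^j_{-2}+H^{j-2}_{-2}H^4_{-2}-H^{j-2}_0=0,\qquad H^j_0+H^{j-2}_{-2}H^4_0=0,$$ and $$H^4_0+2H^3_0H^3_{-2}-(H^3_{-2})^2H^4_{-2}-(H^4_{-2})^2=0,\qquad (H^3_0)^2-(H^3_{-2})^2H^4_0-H^4_{-2}H^4_0=0;$$ the coefficients are uniquely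 determined by the space. This family depends on two parameters: for every $(\alpha,\gamma)\in\mathbb{C}^2$ there are one or two solutions $(H^j_{-2},H^j_0)_{j\ge3}$ of the constraints with $H^3_{-2}=\alpha$, $H^4_{-2}=\gamma$. Fix coefficients satisfying these constraints. (2) The $p_j$, $j\ge3$, are a basis of an infinite-dimensional commutative associative algebra, $p_jp_k=\sum_{l\ge3}C^l_{jk}p_l$, with structure constants $$C^l_{jk}=\delta^l_{j+k}+H^k_{-2}\delta^l_{j+2}+H^k_0\delta^l_j+H^j_{-2}\delta^l_{k+2}+H^j_0\delta^l_k+H^j_{-2}H^k_{-2}\delta^l_4,$$ which satisfy $C^l_{jk}=C^l_{kj}$ and $\sum_sC^s_{ij}C^r_{sk}=\sum_sC^s_{jk}C^r_{is}$. (3) Regard $p_3,p_4,\dots$ as independent variables and let $I\subset\mathbb{C}[p_3,p_4,\dots]$ be the ideal generated by the quadrics $p_jp_k-\sum_lC^l_{jk}p_l$, $j,k\ge3$. Then $I$ is the ideal of all polynomial relations between the polynomials $p_j(z)$, and the common zero set of these quadrics is $\{(p_j(t))_{j\ge3}:t\in\mathbb{C}\}$. (4) Write $a=H^3_{-2}$,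 $b=H^3_0$, $c=H^4_{-2}$, $d=H^4_0$. The ideal $I$ contains the polynomial $$\begin{aligned} F={}&p_4^3-p_3^4+4a\,p_3p_4^2-(3c-2a^2)p_3^2p_4-(-4b+2ac)p_3^3-(3d+4ab+a^4+a^2c)p_4^2\\ &-(4a^2b+8ad-2ac^2-6bc-2a^3c)p_3p_4-(-3cd+6b^2-6abc+2a^2d+a^2c^2+c^3)p_3^2\\ &-(-3d^2-2a^2b^2-2a^2cd-2a^4d+3b^2c+2abc^2-8abd+2a^3bc)p_4\\ &-(-4b^3-4ad^2+6bcd-4a^2bd+6ab^2c+2ac^2d+2a^3cd-2a^2bc^2-2bc^3)p_3 . \end{aligned}$$ The plane curve $F=0$ is a $(3,4)$ curve, that is, $F-(p_4^3-p_3^4)$ is a linear combination of monomials $p_3^ip_4^j$ with $3i+4j<12$; it is irreducible and has geometric genus zero. -/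

import Mathlib

noncomputable section

namespace SigmaThree

/-! ### Formal Laurent series in `1/z` and Birkhoff strata of `Gr⁽²⁾` -/

/-- Formal Laurent series with finitely many positive powers of `z`; the variable of
`LaurentSeries` is `1/z`. -/
abbrev Laurent : Type := LaurentSeries ℂ

/-- The coefficient of `z ^ n`. -/
def zcoeff (f : Laurent) (n : ℤ) : ℂ := HahnSeries.coeff f (-n)

/-- The series `z`. -/
def zvar : Laurent := HahnSeries.single (-1 : ℤ) (1 : ℂ)

/-- `f` has order `n`: its leading term is a nonzero multiple of `z ^ n`. -/
def HasOrder (f : Laurent) (n : ℤ) : Prop :=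
  zcoeff f n ≠ 0 ∧ ∀ m : ℤ, n < m → zcoeff f m = 0

/-- `z² · W ⊆ W`. -/
def ZSqStable (W : Submodule ℂ Laurent) : Prop :=
  ∀ f ∈ W, zvar ^ 2 * f ∈ W

/-- `S_m = {-m, -m+2, ..., m-2, m, m+1, m+2, ...}`. -/
def orderSet (m : ℕ) : Set ℤ :=
  {n | (m : ℤ) ≤ n ∨ ∃ i : ℕ, i ≤ m ∧ n = -(m : ℤ) + 2 * (i : ℤ)}

/-- The stratum `Σ_m` of `Gr⁽²⁾`. -/
def stratum (m : ℕ) : Set (Submodule ℂ Laurent) :=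
  {V | ZSqStable V ∧ {n : ℤ | ∃ f ∈ V, HasOrder f n} = orderSet m}

/-! ### The subset `W₃` -/

/-- The indices `3, 4, 5, ...`. -/
abbrev Idx : Type := {j : ℕ // 3 ≤ j}

def i3 : Idx := ⟨3, le_refl 3⟩

def i4 : Idx := ⟨4, by norm_num⟩

def Idx.plus (j k : Idx) : Idx := ⟨j.1 + k.1, le_trans j.2 (Nat.le_add_right _ _)⟩

def Idx.plusTwo (j : Idx) : Idx := ⟨j.1 + 2, le_trans j.2 (Nat.le_add_right _ _)⟩

/-- The form `p_j = z^j + H^j_{-2} z² + H^j_0 + ∑_{k ≥ 1} H^j_k z^{-k}`, `j ≥ 3`, of the elements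
of the canonical basis: the powers `z^n` with `n = 1` or `n ≥ 3` do not occur, except for the
leading `z^j`; the coefficients at `z²`, `z⁰` and at negative powers are arbitrary. -/
def IsCanonical (p : Idx → Laurent) : Prop :=
  ∀ (j : Idx) (n : ℤ), 1 ≤ n → n ≠ 2 → zcoeff (p j) n = if n = (j.1 : ℤ) then 1 else 0

/-- The subset `W₃`: the vector spaces spanned by Laurent series `p_3, p_4, ...` of canonical form
which are stable under `z²` and closed under multiplication. -/
def W3 : Set (Submodule ℂ Laurent) :=
  {W | (∃ p : Idx → Laurent, IsCanonical p ∧ W = Submodule.span ℂ (Set.range p)) ∧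
    ZSqStable W ∧ ∀ f ∈ W, ∀ g ∈ W, f * g ∈ W}

/-- The coefficients `u j = H^j_{-2}` and `v j = H^j_0`, `j ≥ 3`. -/
@[ext]
structure Params where
  u : Idx → ℂ
  v : Idx → ℂ

namespace Params

variable (h : Params)

/-- The linear recursion and the two nonlinear equations satisfied by the `H^j_{-2}, H^j_0`. -/
def Constraints : Prop :=
  (∀ j : Idx, h.u j.plusTwo + h.u j * h.u i4 - h.v j = 0 ∧
    h.v j.plusTwo + h.u j * h.v i4 = 0) ∧
  h.v i4 + 2 * h.v i3 * h.u i3 - h.u i3 ^ 2 * h.u i4 - h.u i4 ^ 2 = 0 ∧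
  h.v i3 ^ 2 - h.u i3 ^ 2 * h.v i4 - h.u i4 * h.v i4 = 0

/-- The polynomial `p_j = z^j + H^j_{-2} z² + H^j_0`. -/
def poly (j : Idx) : Polynomial ℂ :=
  Polynomial.X ^ j.1 + Polynomial.C (h.u j) * Polynomial.X ^ 2 + Polynomial.C (h.v j)

/-- The polynomial `p_j` as a Laurent series. -/
def series (j : Idx) : Laurent := zvar ^ j.1 + h.u j • zvar ^ 2 + h.v j • 1

/-- The vector space spanned by the `p_j`, `j ≥ 3`. -/
def space : Submodule ℂ Laurent := Submodule.span ℂ (Set.range h.series)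

/-- The structure constants
`C_{jk}^l = δ_{j+k}^l + H^k_{-2} δ_{j+2}^l + H^k_0 δ_j^l + H^j_{-2} δ_{k+2}^l + H^j_0 δ_k^l
  + H^j_{-2} H^k_{-2} δ_4^l`, as a finitely supported function of `l`. -/
def structConst (j k : Idx) : Idx →₀ ℂ :=
  Finsupp.single (j.plus k) 1 + Finsupp.single j.plusTwo (h.u k) + Finsupp.single j (h.v k)
    + Finsupp.single k.plusTwo (h.u j) + Finsupp.single k (h.v j)
    + Finsupp.single i4 (h.u j * h.u k)

/-- The quadric `p_j p_k - ∑_l C_{jk}^l p_l` in independent variables `p_3, p_4, ...`. -/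
def quadric (j k : Idx) : MvPolynomial Idx ℂ :=
  MvPolynomial.X j * MvPolynomial.X k
    - (h.structConst j k).sum fun l c => MvPolynomial.C c * MvPolynomial.X l

/-- The ideal generated by the quadrics. -/
def quadricIdeal : Ideal (MvPolynomial Idx ℂ) :=
  Ideal.span {f | ∃ j k : Idx, f = h.quadric j k}

/-- The left-hand side of the equation of the plane curve, in variables `x = p_3`, `y = p_4`. -/
def curve : MvPolynomial (Fin 2) ℂ :=
  let x : MvPolynomial (Fin 2) ℂ := MvPolynomial.X 0
  let y : MvPolynomial (Fin 2) ℂ := MvPolynomial.X 1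
  let a : MvPolynomial (Fin 2) ℂ := MvPolynomial.C (h.u i3)
  let b : MvPolynomial (Fin 2) ℂ := MvPolynomial.C (h.v i3)
  let c : MvPolynomial (Fin 2) ℂ := MvPolynomial.C (h.u i4)
  let d : MvPolynomial (Fin 2) ℂ := MvPolynomial.C (h.v i4)
  y ^ 3 - x ^ 4 + 4 * a * x * y ^ 2
    - (3 * c - 2 * a ^ 2) * x ^ 2 * y
    - (-4 * b + 2 * a * c) * x ^ 3
    - (3 * d + 4 * b * a + a ^ 4 + a ^ 2 * c) * y ^ 2
    - (4 * a ^ 2 * b + 8 * a * d - 2 * a * c ^ 2 - 6 * b * c - 2 * a ^ 3 * c) * x * y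
    - (-3 * d * c + 6 * b ^ 2 - 6 * b * a * c + 2 * a ^ 2 * d + a ^ 2 * c ^ 2 + c ^ 3) * x ^ 2
    - (-3 * d ^ 2 - 2 * b ^ 2 * a ^ 2 - 2 * a ^ 2 * d * c - 2 * a ^ 4 * d + 3 * b ^ 2 * c
        + 2 * b * a * c ^ 2 - 8 * b * a * d + 2 * b * a ^ 3 * c) * y
    - (-4 * b ^ 3 - 4 * a * d ^ 2 + 6 * b * d * c - 4 * b * d * a ^ 2 + 6 * b ^ 2 * a * c
        + 2 * d * a * c ^ 2 + 2 * d * a ^ 3 * c - 2 * b * a ^ 2 * c ^ 2 - 2 * b * c ^ 3) * x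

end Params

/-! ### Plane curves -/

/-- An `(n, s)` curve: `n, s` are coprime and the equation is `y^n - x^s` plus a linear combination
of monomials `x^i y^j` with `n i + s j < n s`. -/
def IsNSCurve (n s : ℕ) (F : MvPolynomial (Fin 2) ℂ) : Prop :=
  Nat.Coprime n s ∧
  ∀ m ∈ (F - (MvPolynomial.X 1 ^ n - MvPolynomial.X 0 ^ s)).support, n * m 0 + s * m 1 < n * s

/-- The differentials of a field `K` over `ℂ` that are regular at every place of `K`, that is, lie
in the image of `Ω[O⁄ℂ]` for each valuation ring `O` of `K` containing `ℂ`. If `K` is the function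
field of a curve, these are the global regular differentials of its smooth projective model. -/
def regularDifferentials (K : Type) [Field K] [Algebra ℂ K] :
    Submodule ℂ (KaehlerDifferential ℂ K) :=
  ⨅ O : {O : ValuationSubring K // ∀ c : ℂ, algebraMap ℂ K c ∈ O},
    Submodule.span ℂ {w | ∃ f ∈ O.1, ∃ g ∈ O.1, w = f • KaehlerDifferential.D ℂ K g}

/-- The (geometric) genus of the irreducible plane curve `F = 0`: the dimension of the space of
regular differentials of its function field. -/
def genus (F : MvPolynomial (Fin 2) ℂ) [(Ideal.span {F}).IsPrime] : Cardinal :=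
  Module.rank ℂ
    (regularDifferentials (FractionRing (MvPolynomial (Fin 2) ℂ ⧸ Ideal.span {F})))

end SigmaThree

end

noncomputable section

namespace SigmaThree

/-! ### Coefficients of Laurent series in `1/z` -/

/-! The missing power z is the lever for the description of `W3`. The coefficient of z vanishes on
all of W, hence on every z^(2m) p_j and every p_j p_k. The first condition kills the odd negative
coefficients, the second gives H^k_{j-1} = -H^j_{k-1}. Multiplication by z² also translates
coefficients from p_j to p_{j+2}, which turns part of this antisymmetry into a symmetry, so all
negative powers vanish (`IsCanonical.zcoeff_neg_eq_zero`). For the resulting polynomials, stability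
under z² amounts to the linear recursions. Closure under products amounts to `MulRel`: its case p_3²
is the nonlinear pair, and the recursions carry it to all products (`Constraints.mulRel`).

The quadrics reduce every polynomial in the p_j to degree at most one, and 1, p_3, p_4, ... are
linearly independent, so there are no further relations. Since p_3 is monic in z, ℂ[z] is integral
over the image of evaluation, and lying over attaches a point t to each common zero.

The polynomial F vanishes at (p_3(z), p_4(z)) and is monic cubic in p_4. A degree count modulo 3
shows that it generates the kernel of the parametrisation, a prime ideal. As z is a quotient of
polynomials in p_3 and p_4, the function field is ℂ(z). A regular differential there is both P(z) dz
and R(1/z) d(1/z) with polynomials P, R, which forces P = 0. -/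

theorem zcoeff_ext {f g : Laurent} (h : ∀ n, zcoeff f n = zcoeff g n) : f = g := by
  ext n
  simpa [zcoeff] using h (-n)

@[simp]
theorem zcoeff_zero (n : ℤ) : zcoeff 0 n = 0 := rfl

@[simp]
theorem zcoeff_add (f g : Laurent) (n : ℤ) : zcoeff (f + g) n = zcoeff f n + zcoeff g n := rfl

@[simp]
theorem zcoeff_sub (f g : Laurent) (n : ℤ) : zcoeff (f - g) n = zcoeff f n - zcoeff g n := rfl

@[simp]
theorem zcoeff_smul (c : ℂ) (f : Laurent) (n : ℤ) : zcoeff (c • f) n = c * zcoeff f n := rfl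

theorem laurent_smul_mul (c : ℂ) (f g : Laurent) : (c • f) * g = c • (f * g) := by
  rw [← HahnSeries.C_mul_eq_smul, ← HahnSeries.C_mul_eq_smul, mul_assoc]

/-- The coefficient of `z ^ n` as a linear functional. -/
def zcoeffLin (n : ℤ) : Laurent →ₗ[ℂ] ℂ where
  toFun f := zcoeff f n
  map_add' f g := zcoeff_add f g n
  map_smul' c f := zcoeff_smul c f n

@[simp]
theorem zcoeffLin_apply (n : ℤ) (f : Laurent) : zcoeffLin n f = zcoeff f n := rfl

/-- The power `z ^ k` with an integer exponent. -/
def zpowInt (k : ℤ) : Laurent := HahnSeries.single (-k) 1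

theorem zpowInt_mul (k l : ℤ) : zpowInt k * zpowInt l = zpowInt (k + l) := by
  simp [zpowInt, HahnSeries.single_mul_single, add_comm]

theorem zvar_pow (k : ℕ) : zvar ^ k = zpowInt k := by
  simp [zvar, zpowInt, HahnSeries.single_pow]

theorem zpowInt_zero : zpowInt 0 = 1 := by
  simp [zpowInt]

theorem zcoeff_zpowInt_mul (k n : ℤ) (f : Laurent) :
    zcoeff (zpowInt k * f) n = zcoeff f (n - k) := by
  have := HahnSeries.coeff_single_mul_add (r := (1 : ℂ)) (x := f) (a := k - n) (b := -k)
  simp only [zcoeff, zpowInt]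
  rw [show -n = (k - n) + -k by ring, this, one_mul, neg_sub]

theorem zcoeff_zvar_pow_mul (k : ℕ) (n : ℤ) (f : Laurent) :
    zcoeff (zvar ^ k * f) n = zcoeff f (n - k) := by
  rw [zvar_pow, zcoeff_zpowInt_mul]

@[simp]
theorem zcoeff_one (n : ℤ) : zcoeff 1 n = if n = 0 then 1 else 0 := by
  simp [zcoeff, HahnSeries.coeff_one]

@[simp]
theorem zcoeff_zvar_pow (k : ℕ) (n : ℤ) : zcoeff (zvar ^ k) n = if n = k then 1 else 0 := by
  rw [← mul_one (zvar ^ k), zcoeff_zvar_pow_mul, zcoeff_one]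
  simp [sub_eq_zero]

/-- The two exponents of 1/z in each contributing product add up to -n ≤ 0, so one of them is
nonpositive and its factor has coefficient zero there. -/
theorem zcoeff_mul_eq_zero {f g : Laurent} (hf : ∀ n, 0 ≤ n → zcoeff f n = 0)
    (hg : ∀ n, 0 ≤ n → zcoeff g n = 0) {n : ℤ} (hn : 0 ≤ n) : zcoeff (f * g) n = 0 := by
  rw [zcoeff, HahnSeries.coeff_mul]
  refine Finset.sum_eq_zero fun x hx => ?_
  obtain ⟨-, -, h⟩ := Finset.mem_antidiagonal.mp hx
  by_cases h0 : x.1 ≤ 0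
  · have := hf (-x.1) (by omega)
    simp only [zcoeff, neg_neg] at this
    rw [this, zero_mul]
  · have := hg (-x.2) (by omega)
    simp only [zcoeff, neg_neg] at this
    rw [this, mul_zero]

theorem HasOrder.unique {f : Laurent} {m n : ℤ} (hm : HasOrder f m) (hn : HasOrder f n) :
    m = n := by
  rcases lt_trichotomy m n with h | h | h
  · exact absurd (hm.2 n h) hn.1
  · exact h
  · exact absurd (hn.2 m h) hm.1

/-- The orders occurring in the span of a family with prescribed orders. -/
theorem setOf_hasOrder_span {S : Set ℤ} {e : ℤ → Laurent} (he : ∀ n ∈ S, HasOrder (e n) n) :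
    {n : ℤ | ∃ f ∈ Submodule.span ℂ (e '' S), HasOrder f n} = S := by
  ext n
  constructor
  · rintro ⟨f, hf, hn⟩
    obtain ⟨c, hc, rfl⟩ := (Finsupp.mem_span_image_iff_linearCombination ℂ).mp hf
    have hc0 : c ≠ 0 := by
      rintro rfl
      exact hn.1 (by simp)
    have hne : c.support.Nonempty := Finsupp.support_nonempty_iff.mpr hc0
    have hsup : ∀ s ∈ c.support, s ∈ S := fun s hs => (Finsupp.mem_supported ℂ c).mp hc hs
    have hcoe : ∀ m, zcoeff (Finsupp.linearCombination ℂ e c) m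
        = ∑ s ∈ c.support, c s * zcoeff (e s) m := by
      intro m
      rw [← zcoeffLin_apply, Finsupp.linearCombination_apply, Finsupp.sum, map_sum]
      simp
    have hmax := Finset.max'_mem _ hne
    -- The orders in the family are pairwise distinct, so the term of largest index cannot be
    -- cancelled.
    have hord : HasOrder (Finsupp.linearCombination ℂ e c) (c.support.max' hne) := by
      constructor
      · rw [hcoe, Finset.sum_eq_single_of_mem _ hmax]
        · exact mul_ne_zero (Finsupp.mem_support_iff.mp hmax) (he _ (hsup _ hmax)).1
        · intro s hs hsne
          rw [(he s (hsup s hs)).2 _ (lt_of_le_of_ne (Finset.le_max' _ s hs) hsne), mul_zero]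
      · intro m hm
        rw [hcoe]
        refine Finset.sum_eq_zero fun s hs => ?_
        rw [(he s (hsup s hs)).2 _ (lt_of_le_of_lt (Finset.le_max' _ s hs) hm), mul_zero]
    rw [hn.unique hord]
    exact hsup _ hmax
  · intro hn
    exact ⟨e n, Submodule.subset_span ⟨n, hn, rfl⟩, he n hn⟩

/-! ### Spaces with a canonical basis -/

theorem IsCanonical.zcoeff_one_eq_zero {p : Idx → Laurent} (hp : IsCanonical p) {f : Laurent}
    (hf : f ∈ Submodule.span ℂ (Set.range p)) : zcoeff f 1 = 0 := by
  have : Submodule.span ℂ (Set.range p) ≤ LinearMap.ker (zcoeffLin 1) := by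
    rw [Submodule.span_le]
    rintro _ ⟨j, rfl⟩
    have hj := j.2
    simp only [SetLike.mem_coe, LinearMap.mem_ker, zcoeffLin_apply]
    rw [hp j 1 le_rfl (by norm_num), if_neg (by omega)]
  exact this hf

theorem IsCanonical.zcoeff_linearCombination {p : Idx → Laurent} (hp : IsCanonical p)
    (c : Idx →₀ ℂ) (j : Idx) : zcoeff (Finsupp.linearCombination ℂ p c) j.1 = c j := by
  have hj := j.2
  rw [← zcoeffLin_apply, Finsupp.linearCombination_apply, Finsupp.sum, map_sum]
  have : ∀ s ∈ c.support, zcoeffLin j.1 (c s • p s) = if j = s then c s else 0 := by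
    intro s _
    rw [map_smul, zcoeffLin_apply, hp s _ (by omega) (by omega)]
    simp [Subtype.ext_iff]
  rw [Finset.sum_congr rfl this]
  simp +contextual [eq_comm]

/-- The coefficient at z^j, j ≥ 3, is the coordinate along p_j. Identities inside the space can
therefore be checked on powers z³ and higher alone. -/
theorem IsCanonical.eq_zero {p : Idx → Laurent} (hp : IsCanonical p) {f : Laurent}
    (hf : f ∈ Submodule.span ℂ (Set.range p)) (h : ∀ n : ℤ, 3 ≤ n → zcoeff f n = 0) : f = 0 := by
  obtain ⟨c, rfl⟩ := (Finsupp.mem_span_range_iff_exists_finsupp).mp hf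
  have hc : c = 0 := by
    ext j
    rw [← hp.zcoeff_linearCombination c j]
    have hj := j.2
    exact h _ (by omega)
  simp [hc]

theorem IsCanonical.linearIndependent {p : Idx → Laurent} (hp : IsCanonical p) :
    LinearIndependent ℂ p := by
  rw [linearIndependent_iff]
  intro c hc
  ext j
  rw [← hp.zcoeff_linearCombination c j, hc]
  rfl

/-! ### Consequences of stability under z² and under products. -/

theorem IsCanonical.zvar_sq_mul {p : Idx → Laurent} (hp : IsCanonical p)
    (hz : ZSqStable (Submodule.span ℂ (Set.range p))) (j : Idx) :
    zvar ^ 2 * p j = p j.plusTwo + zcoeff (p j) 2 • p i4 := by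
  have hmem : ∀ k, p k ∈ Submodule.span ℂ (Set.range p) :=
    fun k => Submodule.subset_span ⟨k, rfl⟩
  rw [← sub_eq_zero]
  refine hp.eq_zero (Submodule.sub_mem _ (hz _ (hmem j))
    (Submodule.add_mem _ (hmem _) (Submodule.smul_mem _ _ (hmem _)))) fun n hn => ?_
  have hj := j.2
  rw [zcoeff_sub, zcoeff_add, zcoeff_smul, zcoeff_zvar_pow_mul, hp _ n (by omega) (by omega),
    hp _ n (by omega) (by omega)]
  have hj2 : (j.plusTwo.1 : ℤ) = j.1 + 2 := by simp [Idx.plusTwo]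
  have hi4 : (i4.1 : ℤ) = 4 := by simp [i4]
  rw [hj2, hi4]
  push_cast
  by_cases h4 : n = 4
  · subst h4
    rw [if_neg (by omega)]
    norm_num
  · rw [hp j (n - 2) (by omega) (by omega), if_neg h4]
    simp [sub_eq_iff_eq_add]

theorem IsCanonical.zcoeff_sub_two {p : Idx → Laurent} (hp : IsCanonical p)
    (hz : ZSqStable (Submodule.span ℂ (Set.range p))) (j : Idx) (n : ℤ) :
    zcoeff (p j) (n - 2) = zcoeff (p j.plusTwo) n + zcoeff (p j) 2 * zcoeff (p i4) n := by
  have := congrArg (fun f => zcoeff f n) (hp.zvar_sq_mul hz j)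
  simpa [zcoeff_zvar_pow_mul] using this

/-- The shift relation descends in steps of two from the coefficient of z, which vanishes for every
basis element; closure under products is not needed. -/
theorem IsCanonical.zcoeff_neg_odd {p : Idx → Laurent} (hp : IsCanonical p)
    (hz : ZSqStable (Submodule.span ℂ (Set.range p))) (m : ℕ) (j : Idx) : zcoeff (p j) (-(2 * m + 1)) = 0 := by
  induction m generalizing j with
  | zero =>
    have hone : ∀ k : Idx, zcoeff (p k) 1 = 0 :=
      fun k => hp.zcoeff_one_eq_zero (Submodule.subset_span ⟨k, rfl⟩)
    have := hp.zcoeff_sub_two hz j 1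
    rw [hone, hone] at this
    simpa using this
  | succ m ih =>
    have := hp.zcoeff_sub_two hz j (-(2 * m + 1))
    rw [ih, ih] at this
    rw [show (-(2 * ((m + 1 : ℕ) : ℤ) + 1)) = -(2 * m + 1) - 2 by push_cast; ring, this]
    ring

/-- This is the coefficient of z in p_j p_k. With P the part in nonnegative powers and N = p - P,
neither P_j P_k nor N_j N_k contains z. In P_j N_k only z^j contributes: z² would meet the
coefficient of z^{-1}, which is zero, and the constant would meet a nonnegative power in N_k. -/
theorem IsCanonical.zcoeff_antisymm {p : Idx → Laurent} (hp : IsCanonical p)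
    (hz : ZSqStable (Submodule.span ℂ (Set.range p)))
    (hm : ∀ f ∈ Submodule.span ℂ (Set.range p), ∀ g ∈ Submodule.span ℂ (Set.range p),
      f * g ∈ Submodule.span ℂ (Set.range p)) (j k : Idx) :
    zcoeff (p k) (1 - j.1) + zcoeff (p j) (1 - k.1) = 0 := by
  have hmem : ∀ k, p k ∈ Submodule.span ℂ (Set.range p) :=
    fun k => Submodule.subset_span ⟨k, rfl⟩
  have h1 := hp.zcoeff_one_eq_zero (hm _ (hmem j) _ (hmem k))
  have hj := j.2
  have hk := k.2
  let P : Idx → Laurent := fun j => zvar ^ j.1 + zcoeff (p j) 2 • zvar ^ 2 + zcoeff (p j) 0 • 1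
  have hN : ∀ (j : Idx) (n : ℤ), zcoeff (p j - P j) n = if 0 ≤ n then 0 else zcoeff (p j) n := by
    intro j n
    have hj := j.2
    simp only [P, zcoeff_sub, zcoeff_add, zcoeff_smul, zcoeff_zvar_pow, zcoeff_one]
    push_cast
    by_cases h0 : 0 ≤ n
    · rw [if_pos h0]
      by_cases h00 : n = 0
      · subst h00
        rw [if_neg (by omega), if_neg (by omega)]
        simp
      · by_cases h2 : n = 2
        · subst h2
          rw [if_neg (by omega)]
          simp
        · rw [hp j n (by omega) h2, if_neg h2, if_neg h00]
          ring
    · rw [if_neg h0, if_neg (by omega), if_neg (by omega), if_neg (by omega)]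
      ring
  have hNN : zcoeff ((p j - P j) * (p k - P k)) 1 = 0 :=
    zcoeff_mul_eq_zero (fun n hn => by rw [hN, if_pos hn]) (fun n hn => by rw [hN, if_pos hn])
      (by norm_num)
  have hodd : ∀ k : Idx, zcoeff (p k) (-1) = 0 := fun k => by
    simpa using hp.zcoeff_neg_odd hz 0 k
  have hPmul : ∀ (j : Idx) (f : Laurent) (n : ℤ), zcoeff (P j * f) n
      = zcoeff f (n - j.1) + zcoeff (p j) 2 * zcoeff f (n - 2) + zcoeff (p j) 0 * zcoeff f n := by
    intro j f n
    simp only [P, add_mul, laurent_smul_mul, one_mul, zcoeff_add, zcoeff_smul, zcoeff_zvar_pow_mul]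
    push_cast
    rfl
  have hPN : ∀ j k : Idx, zcoeff (P j * (p k - P k)) 1 = zcoeff (p k) (1 - j.1) := by
    intro j k
    have hj := j.2
    rw [hPmul, hN, hN, hN, if_neg (by omega), if_neg (by omega), if_pos (by omega),
      show (1 : ℤ) - 2 = -1 by norm_num, hodd]
    ring
  have hPP : zcoeff (P j * P k) 1 = 0 := by
    rw [hPmul]
    simp only [P, zcoeff_add, zcoeff_smul, zcoeff_zvar_pow, zcoeff_one]
    push_cast
    repeat rw [if_neg (by omega)]
    ring
  have hdec : p j * p k = P j * P k + P j * (p k - P k) + P k * (p j - P j)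
      + (p j - P j) * (p k - P k) := by ring
  rw [hdec, zcoeff_add, zcoeff_add, zcoeff_add, hPP, hPN, hPN, hNN] at h1
  simpa using h1

/-- In a space closed under multiplication, the canonical basis has no negative powers. -/
theorem IsCanonical.zcoeff_neg_eq_zero {p : Idx → Laurent} (hp : IsCanonical p)
    (hz : ZSqStable (Submodule.span ℂ (Set.range p)))
    (hm : ∀ f ∈ Submodule.span ℂ (Set.range p), ∀ g ∈ Submodule.span ℂ (Set.range p),
      f * g ∈ Submodule.span ℂ (Set.range p)) (j : Idx) (n : ℤ) (hn : n < 0) :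
    zcoeff (p j) n = 0 := by
  have hodd : ∀ (j : Idx) (n : ℤ), n < 0 → n % 2 = 1 → zcoeff (p j) n = 0 := by
    intro j n hn h
    have := hp.zcoeff_neg_odd hz ((-n - 1) / 2).toNat j
    rwa [show -(2 * (((-n - 1) / 2).toNat : ℤ) + 1) = n by omega] at this
  have hanti := hp.zcoeff_antisymm hz hm
  -- Antisymmetry pairs this coefficient with that of p_{1-n} at z^{1-j}, an odd negative power when
  -- j is even. The case n = -1 is separate because 1 - n = 2 is not an index.
  have heven : ∀ (j : Idx) (n : ℤ), n < 0 → j.1 % 2 = 0 → zcoeff (p j) n = 0 := by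
    intro j n hn h
    by_cases hn1 : n = -1
    · exact hodd j n hn (by omega)
    · have := hanti ⟨(1 - n).toNat, by omega⟩ j
      simp only at this
      have hj := j.2
      rw [show (1 - ((1 - n).toNat : ℤ)) = n by omega, hodd _ (1 - j.1) (by omega) (by omega)] at this
      simpa using this
  -- The correction term in the shift relation involves negative powers in p_4, already zero by
  -- `heven`. Coefficients are thus translated unchanged as long as the exponent stays negative.
  have hshift : ∀ (i : ℕ) (j : Idx) (n : ℤ), n + 2 * i < 0 →
      zcoeff (p j) n = zcoeff (p ⟨j.1 + 2 * i, by have := j.2; omega⟩) (n + 2 * i) := by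
    intro i
    induction i with
    | zero => intro j n _; simp
    | succ i ih =>
      intro j n hni
      push_cast at hni
      have h1 := hp.zcoeff_sub_two hz j (n + 2)
      rw [heven i4 (n + 2) (by omega) (by simp [i4]), mul_zero, add_zero, add_sub_cancel_right]
        at h1
      rw [h1, ih _ _ (by omega)]
      congr 1
      · congr 2
        simp only [Idx.plusTwo]
        ring
      · push_cast
        ring
  -- Translation by k - j identifies the coefficient of p_j at z^{1-k} with that of p_k at z^{1-j},
  -- while antisymmetry says that they are opposite; hence both vanish.
  have hle : ∀ (j k : Idx), j.1 % 2 = k.1 % 2 → j.1 ≤ k.1 → zcoeff (p j) (1 - k.1) = 0 := by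
    intro j k hpar hjk
    have hj := j.2
    have h1 := hshift ((k.1 - j.1) / 2) j (1 - k.1) (by omega)
    have hk : (⟨j.1 + 2 * ((k.1 - j.1) / 2), by omega⟩ : Idx) = k := Subtype.ext (by simp; omega)
    rw [hk, show (1 - k.1 + 2 * ((k.1 - j.1) / 2 : ℕ) : ℤ) = 1 - j.1 by omega] at h1
    have h2 := hanti j k
    rw [← h1] at h2
    simpa using h2
  by_cases hj2 : j.1 % 2 = 0
  · exact heven j n hn hj2
  by_cases hn2 : n % 2 = 1
  · exact hodd j n hn hn2
  have hj := j.2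
  let k : Idx := ⟨(1 - n).toNat, by omega⟩
  have hk : k.1 = (1 - n).toNat := rfl
  have hnk : n = 1 - k.1 := by omega
  rw [hnk]
  rcases le_total j.1 k.1 with h | h
  · exact hle j k (by omega) h
  · have h1 := hanti j k
    rw [hle k j (by omega) h] at h1
    simpa using h1

namespace Params

variable {h : Params}

/-! ### Consequences of the constraints -/

/-- `H^{i+3}_{-2}` -/
def uNat (h : Params) (i : ℕ) : ℂ := h.u ⟨i + 3, by omega⟩

/-- `H^{i+3}_0` -/
def vNat (h : Params) (i : ℕ) : ℂ := h.v ⟨i + 3, by omega⟩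

theorem Constraints.uNat_add_two (hc : h.Constraints) (i : ℕ) :
    h.uNat (i + 2) = h.vNat i - h.uNat i * h.uNat 1 := by
  have := (hc.1 ⟨i + 3, by omega⟩).1
  change h.uNat (i + 2) + h.uNat i * h.uNat 1 - h.vNat i = 0 at this
  linear_combination this

theorem Constraints.vNat_add_two (hc : h.Constraints) (i : ℕ) :
    h.vNat (i + 2) = -(h.uNat i * h.vNat 1) := by
  have := (hc.1 ⟨i + 3, by omega⟩).2
  change h.vNat (i + 2) + h.uNat i * h.vNat 1 = 0 at this
  linear_combination this

theorem Constraints.eq_one (hc : h.Constraints) :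
    h.vNat 1 + 2 * h.vNat 0 * h.uNat 0 - h.uNat 0 ^ 2 * h.uNat 1 - h.uNat 1 ^ 2 = 0 := hc.2.1

theorem Constraints.eq_two (hc : h.Constraints) :
    h.vNat 0 ^ 2 - h.uNat 0 ^ 2 * h.vNat 1 - h.uNat 1 * h.vNat 1 = 0 := hc.2.2

/-- The quadratic relations between the coefficients which express that the product of two basis
elements is a linear combination of basis elements. -/
def MulRel (h : Params) (i k : ℕ) : Prop :=
  h.uNat (i + k + 3) = h.uNat 1 * h.uNat i * h.uNat k - h.uNat i * h.vNat k - h.uNat k * h.vNat i ∧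
  h.vNat (i + k + 3) = h.vNat 1 * h.uNat i * h.uNat k - h.vNat i * h.vNat k

theorem MulRel.symm {i k : ℕ} (hm : h.MulRel i k) : h.MulRel k i := by
  obtain ⟨h1, h2⟩ := hm
  rw [show i + k = k + i by omega] at h1 h2
  exact ⟨by rw [h1]; ring, by rw [h2]; ring⟩

/-- Both sides obey the same recursion in i, the one coming from multiplication by z². -/
theorem Constraints.mulRel_add_two (hc : h.Constraints) {i k : ℕ} (hm : h.MulRel i k) :
    h.MulRel (i + 2) k := by
  obtain ⟨h1, h2⟩ := hm
  rw [MulRel, show i + 2 + k + 3 = i + k + 3 + 2 by omega, hc.uNat_add_two (i + k + 3),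
    hc.vNat_add_two (i + k + 3), h1, h2, hc.uNat_add_two i, hc.vNat_add_two i]
  exact ⟨by ring, by ring⟩

theorem Constraints.mulRel_of_base (hc : h.Constraints) {k : ℕ} (h0 : h.MulRel 0 k)
    (h1 : h.MulRel 1 k) (i : ℕ) : h.MulRel i k := by
  induction i using Nat.twoStepInduction with
  | zero => exact h0
  | one => exact h1
  | more i hi _ => exact hc.mulRel_add_two hi

theorem Constraints.mulRel (hc : h.Constraints) (i k : ℕ) : h.MulRel i k := by
  have e1 := hc.eq_one
  have e2 := hc.eq_two
  have u2 := hc.uNat_add_two 0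
  have v2 := hc.vNat_add_two 0
  have u3 := hc.uNat_add_two 1
  have v3 := hc.vNat_add_two 1
  have u4 := hc.uNat_add_two 2
  have v4 := hc.vNat_add_two 2
  have u5 := hc.uNat_add_two 3
  have v5 := hc.vNat_add_two 3
  norm_num at u2 v2 u3 v3 u4 v4 u5 v5
  -- Index 0 stands for p_3 and 1 for p_4. Only p_3² needs the nonlinear constraints; p_3 p_4 and
  -- p_4² follow from the recursions.
  have h00 : h.MulRel 0 0 := by
    constructor
    · norm_num
      rw [u3]; linear_combination e1
    · norm_num
      rw [v3]; linear_combination e2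
  have h01 : h.MulRel 0 1 := by
    constructor
    · norm_num
      rw [u4, v2, u2]; ring
    · norm_num
      rw [v4, u2]; ring
  have h11 : h.MulRel 1 1 := by
    constructor
    · norm_num
      rw [u5, v3, u3]; ring
    · norm_num
      rw [v5, u3]; ring
  exact hc.mulRel_of_base (hc.mulRel_of_base h00 h01.symm k).symm
    (hc.mulRel_of_base h01 h11 k).symm i

/-- The multiplication table, for the values of the `p_j` at a point of an arbitrary ring. -/
theorem Constraints.mul_eq (hc : h.Constraints) {R : Type*} [CommRing R] (φ : ℂ →+* R) (z : R)
    {P : Idx → R} (hP : ∀ j, P j = z ^ j.1 + φ (h.u j) * z ^ 2 + φ (h.v j)) (j k : Idx) :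
    P j * P k = P (j.plus k) + φ (h.u k) * P j.plusTwo + φ (h.v k) * P j
      + φ (h.u j) * P k.plusTwo + φ (h.v j) * P k + φ (h.u j * h.u k) * P i4 := by
  obtain ⟨j, hj⟩ := j
  obtain ⟨k, hk⟩ := k
  obtain ⟨i, rfl⟩ := Nat.exists_eq_add_of_le' hj
  obtain ⟨l, rfl⟩ := Nat.exists_eq_add_of_le' hk
  have hm := hc.mulRel i l
  have eu : h.u (Idx.plus ⟨i + 3, hj⟩ ⟨l + 3, hk⟩) = h.uNat (i + l + 3) := by
    simp only [uNat, Idx.plus]; congr 2; omega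
  have ev : h.v (Idx.plus ⟨i + 3, hj⟩ ⟨l + 3, hk⟩) = h.vNat (i + l + 3) := by
    simp only [vNat, Idx.plus]; congr 2; omega
  have eu2 : ∀ i hi, h.u (Idx.plusTwo ⟨i + 3, hi⟩) = h.vNat i - h.uNat i * h.uNat 1 :=
    fun i _ => hc.uNat_add_two i
  have ev2 : ∀ i hi, h.v (Idx.plusTwo ⟨i + 3, hi⟩) = -(h.uNat i * h.vNat 1) :=
    fun i _ => hc.vNat_add_two i
  have eu0 : ∀ i hi, h.u ⟨i + 3, hi⟩ = h.uNat i := fun _ _ => rfl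
  have ev0 : ∀ i hi, h.v ⟨i + 3, hi⟩ = h.vNat i := fun _ _ => rfl
  have eu4 : h.u i4 = h.uNat 1 := rfl
  have ev4 : h.v i4 = h.vNat 1 := rfl
  simp only [hP, eu, ev, eu2, ev2, eu0, ev0, eu4, ev4, hm.1, hm.2, map_mul, map_sub, map_neg]
  simp only [Idx.plus, Idx.plusTwo, i4]
  ring

/-- Comparing the coefficients of z² and of 1 gives exactly the two linear recursions. -/
theorem Constraints.sq_mul_eq (hc : h.Constraints) {R : Type*} [CommRing R] (φ : ℂ →+* R) (z : R)
    {P : Idx → R} (hP : ∀ j, P j = z ^ j.1 + φ (h.u j) * z ^ 2 + φ (h.v j)) (j : Idx) :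
    z ^ 2 * P j = P j.plusTwo + φ (h.u j) * P i4 := by
  have h1 := congrArg φ (hc.1 j).1
  have h2 := congrArg φ (hc.1 j).2
  simp only [map_add, map_sub, map_mul, map_zero] at h1 h2
  simp only [hP]
  simp only [Idx.plusTwo, i4] at *
  linear_combination (-z ^ 2) * h1 - h2

/-! ### The space of a parameter -/

theorem isCanonical_series (h : Params) : IsCanonical h.series := by
  intro j n h1 h2
  have hj := j.2
  simp only [series, zcoeff_add, zcoeff_smul, zcoeff_zvar_pow, zcoeff_one]
  push_cast
  rw [if_neg h2, if_neg (show ¬ n = 0 by omega)]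
  ring

theorem zcoeff_series_two (h : Params) (j : Idx) : zcoeff (h.series j) 2 = h.u j := by
  have hj := j.2
  simp only [series, zcoeff_add, zcoeff_smul, zcoeff_zvar_pow, zcoeff_one]
  push_cast
  rw [if_neg (by omega)]
  simp

theorem zcoeff_series_zero (h : Params) (j : Idx) : zcoeff (h.series j) 0 = h.v j := by
  have hj := j.2
  simp only [series, zcoeff_add, zcoeff_smul, zcoeff_zvar_pow, zcoeff_one]
  push_cast
  rw [if_neg (by omega)]
  simp

theorem series_mem_space (h : Params) (j : Idx) : h.series j ∈ h.space :=
  Submodule.subset_span ⟨j, rfl⟩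

/-- The constant series. -/
def laurentC : ℂ →+* Laurent := HahnSeries.C

theorem laurentC_mul (c : ℂ) (f : Laurent) : laurentC c * f = c • f := HahnSeries.C_mul_eq_smul

theorem series_eq (h : Params) (j : Idx) : h.series j =
    zvar ^ j.1 + laurentC (h.u j) * zvar ^ 2 + laurentC (h.v j) := by
  rw [series, laurentC_mul, ← laurentC_mul (h.v j), mul_one]

theorem Constraints.zvar_sq_mul_series (hc : h.Constraints) (j : Idx) :
    zvar ^ 2 * h.series j = h.series j.plusTwo + h.u j • h.series i4 := by
  rw [hc.sq_mul_eq (R := Laurent) laurentC zvar h.series_eq, laurentC_mul]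

theorem Constraints.series_mul_series (hc : h.Constraints) (j k : Idx) :
    h.series j * h.series k = (h.structConst j k).sum fun l c => c • h.series l := by
  rw [hc.mul_eq (R := Laurent) laurentC zvar h.series_eq]
  simp only [laurentC_mul]
  change _ = Finsupp.linearCombination ℂ h.series (h.structConst j k)
  simp only [structConst, map_add, Finsupp.linearCombination_single, one_smul]

theorem Constraints.zSqStable_space (hc : h.Constraints) : ZSqStable h.space := by
  intro f hf
  induction hf using Submodule.span_induction with
  | mem x hx =>
    obtain ⟨j, rfl⟩ := hx
    rw [hc.zvar_sq_mul_series]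
    exact add_mem (h.series_mem_space _) (Submodule.smul_mem _ _ (h.series_mem_space _))
  | zero => simp
  | add x y _ _ hx hy => rw [mul_add]; exact add_mem hx hy
  | smul c x _ hx =>
    rw [mul_comm, laurent_smul_mul, mul_comm]
    exact Submodule.smul_mem _ _ hx

theorem Constraints.mul_mem_space (hc : h.Constraints) {f g : Laurent} (hf : f ∈ h.space)
    (hg : g ∈ h.space) : f * g ∈ h.space := by
  induction hf using Submodule.span_induction with
  | mem x hx =>
    obtain ⟨j, rfl⟩ := hx
    induction hg using Submodule.span_induction with
    | mem y hy =>
      obtain ⟨k, rfl⟩ := hy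
      rw [hc.series_mul_series]
      exact Submodule.sum_mem _ fun l _ => Submodule.smul_mem _ _ (h.series_mem_space l)
    | zero => simp
    | add x y _ _ hx hy => rw [mul_add]; exact add_mem hx hy
    | smul c x _ hx =>
      rw [mul_comm, laurent_smul_mul, mul_comm]
      exact Submodule.smul_mem _ _ hx
  | zero => simp
  | add x y _ _ hx hy => rw [add_mul]; exact add_mem hx hy
  | smul c x _ hx =>
    rw [laurent_smul_mul]
    exact Submodule.smul_mem _ _ hx

theorem Constraints.space_mem_W3 (hc : h.Constraints) : h.space ∈ W3 :=
  ⟨⟨h.series, h.isCanonical_series, rfl⟩, hc.zSqStable_space,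
    fun _ hf _ hg => hc.mul_mem_space hf hg⟩

/-! ### Uniqueness of the coefficients and necessity of the constraints. -/

theorem space_injective : Function.Injective Params.space := by
  intro h k hhk
  have hs : h.series = k.series := by
    funext j
    rw [← sub_eq_zero]
    refine k.isCanonical_series.eq_zero
      (Submodule.sub_mem k.space (hhk ▸ h.series_mem_space j) (k.series_mem_space j)) fun n hn => ?_
    rw [zcoeff_sub, h.isCanonical_series j n (by omega) (by omega),
      k.isCanonical_series j n (by omega) (by omega), sub_self]
  ext j
  · rw [← zcoeff_series_two, ← zcoeff_series_two, hs]
  · rw [← zcoeff_series_zero, ← zcoeff_series_zero, hs]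

theorem constraints_of_space (h : Params) (hz : ZSqStable h.space)
    (hm : ∀ f ∈ h.space, ∀ g ∈ h.space, f * g ∈ h.space) : h.Constraints := by
  have hlin : ∀ j : Idx, h.u j.plusTwo + h.u j * h.u i4 - h.v j = 0 ∧
      h.v j.plusTwo + h.u j * h.v i4 = 0 := by
    intro j
    have key := h.isCanonical_series.zcoeff_sub_two hz j
    have h2 := key 2
    have h0 := key 0
    have hneg := h.isCanonical_series.zcoeff_neg_eq_zero hz hm j (0 - 2) (by norm_num)
    rw [hneg] at h0
    simp only [sub_self, zcoeff_series_two, zcoeff_series_zero] at h0 h2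
    exact ⟨by rw [h2]; ring, h0.symm⟩
  -- The subtracted combination removes every power z³ and higher from p_3². The remainder lies in
  -- the space and in the span of z² and 1, so it is zero; its two coefficients give the nonlinear
  -- equations.
  have hr : h.series i3 * h.series i3 - (h.series (i3.plus i3) + (2 * h.u i3) • h.series i3.plusTwo
        + (h.u i3 ^ 2) • h.series i4 + (2 * h.v i3) • h.series i3)
      = (-(h.u (i3.plus i3) + 2 * h.u i3 * h.u i3.plusTwo + h.u i3 ^ 2 * h.u i4)) • zvar ^ 2
        + (-(h.v i3 ^ 2 + h.v (i3.plus i3) + 2 * h.u i3 * h.v i3.plusTwo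
          + h.u i3 ^ 2 * h.v i4)) • 1 := by
    simp only [series_eq, ← laurentC_mul, map_neg, map_add, map_mul, map_pow]
    rw [show laurentC (2 : ℂ) = 2 from map_ofNat _ 2]
    simp only [Idx.plus, Idx.plusTwo, i3, i4]
    ring
  have hmem := Submodule.sub_mem h.space
    (hm _ (h.series_mem_space i3) _ (h.series_mem_space i3))
    (add_mem (add_mem (add_mem (h.series_mem_space (i3.plus i3))
      (Submodule.smul_mem _ (2 * h.u i3) (h.series_mem_space i3.plusTwo)))
      (Submodule.smul_mem _ (h.u i3 ^ 2) (h.series_mem_space i4)))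
      (Submodule.smul_mem _ (2 * h.v i3) (h.series_mem_space i3)))
  rw [hr] at hmem
  have hzero := h.isCanonical_series.eq_zero hmem fun n hn => by
    simp only [zcoeff_add, zcoeff_smul, zcoeff_zvar_pow, zcoeff_one]
    push_cast
    rw [if_neg (by omega), if_neg (by omega)]
    ring
  have e2 := congrArg (fun f => zcoeff f 2) hzero
  have e0 := congrArg (fun f => zcoeff f 0) hzero
  simp only [zcoeff_add, zcoeff_smul, zcoeff_zvar_pow, zcoeff_one, zcoeff_zero] at e2 e0
  norm_num at e2 e0
  have h5 := hlin i3
  have h6 := hlin i4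
  rw [show i4.plusTwo = i3.plus i3 from rfl] at h6
  refine ⟨hlin, ?_, ?_⟩
  · linear_combination -e2 - h6.1 - 2 * h.u i3 * h5.1
  · linear_combination -e0 - h6.2 - 2 * h.u i3 * h5.2
end Params

theorem exists_params_of_mem_W3 {W : Submodule ℂ Laurent} (hW : W ∈ W3) :
    ∃ h : Params, h.Constraints ∧ h.space = W := by
  obtain ⟨⟨p, hp, rfl⟩, hz, hm⟩ := hW
  let h : Params := ⟨fun j => zcoeff (p j) 2, fun j => zcoeff (p j) 0⟩
  have hs : h.series = p := by
    funext j
    refine zcoeff_ext fun n => ?_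
    have hj := j.2
    rcases lt_trichotomy n 0 with hn | rfl | hn
    · rw [hp.zcoeff_neg_eq_zero hz hm j n hn]
      simp only [Params.series, zcoeff_add, zcoeff_smul, zcoeff_zvar_pow, zcoeff_one]
      push_cast
      repeat rw [if_neg (by omega)]
      ring
    · exact h.zcoeff_series_zero j
    · by_cases h2 : n = 2
      · subst h2
        exact h.zcoeff_series_two j
      · rw [hp j n (by omega) h2, h.isCanonical_series j n (by omega) h2]
  have hsp : h.space = Submodule.span ℂ (Set.range p) := by rw [Params.space, hs]
  rw [← hsp] at hz hm
  exact ⟨h, h.constraints_of_space hz hm, hsp⟩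

theorem bijOn_space : Set.BijOn Params.space {h | h.Constraints} W3 :=
  ⟨fun _ hc => Params.Constraints.space_mem_W3 hc, Params.space_injective.injOn,
    fun _ hW => exists_params_of_mem_W3 hW⟩

/-! ### The stratum -/

/-- A family of elements of orders `-3, -1, 1, 3, 4, 5, ...` spanning a space which contains the
space of `h`. -/
def Params.extension (h : Params) (n : ℤ) : Laurent :=
  if n % 2 = 1 then zpowInt (n - 3) * h.series i3 else zpowInt (n - 4) * h.series i4

theorem Params.hasOrder_series (h : Params) (j : Idx) : HasOrder (h.series j) j.1 := by
  have hj := j.2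
  constructor
  · rw [h.isCanonical_series j _ (by omega) (by omega), if_pos rfl]
    exact one_ne_zero
  · intro m hm
    rw [h.isCanonical_series j _ (by omega) (by omega), if_neg (by omega)]

theorem HasOrder.zpowInt_mul {f : Laurent} {n : ℤ} (hf : HasOrder f n) (k : ℤ) :
    HasOrder (zpowInt k * f) (k + n) := by
  constructor
  · rw [zcoeff_zpowInt_mul, add_sub_cancel_left]
    exact hf.1
  · intro m hm
    rw [zcoeff_zpowInt_mul]
    exact hf.2 _ (by omega)

theorem Params.hasOrder_extension (h : Params) (n : ℤ) : HasOrder (h.extension n) n := by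
  rw [extension]
  split_ifs
  · convert (h.hasOrder_series i3).zpowInt_mul (n - 3) using 1
    simp [i3]
  · convert (h.hasOrder_series i4).zpowInt_mul (n - 4) using 1
    simp [i4]

theorem Params.zvar_sq_mul_extension (h : Params) (n : ℤ) :
    zvar ^ 2 * h.extension n = h.extension (n + 2) := by
  rw [extension, extension, zvar_pow]
  have : (n + 2) % 2 = n % 2 := by omega
  rw [this]
  split_ifs
  · rw [← mul_assoc, SigmaThree.zpowInt_mul]; congr 2; push_cast; ring
  · rw [← mul_assoc, SigmaThree.zpowInt_mul]; congr 2; push_cast; ring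

theorem add_two_mem_orderSet {m : ℕ} {n : ℤ} (hn : n ∈ orderSet m) : n + 2 ∈ orderSet m := by
  rcases hn with hn | ⟨i, hi, rfl⟩
  · exact Or.inl (by omega)
  · by_cases him : i = m
    · exact Or.inl (by omega)
    · exact Or.inr ⟨i + 1, by omega, by push_cast; ring⟩

/-- The space V is spanned by the z^{2k} p_3 of odd order at least -3 and the z^{2k} p_4 of even
order at least 4. It contains W because p_{j+2} = z² p_j - H^j_{-2} p_4. -/
theorem exists_stratum_of_mem_W3 {W : Submodule ℂ Laurent} (hW : W ∈ W3) :
    ∃ V ∈ stratum 3, W ≤ V := by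
  obtain ⟨h, hc, rfl⟩ := exists_params_of_mem_W3 hW
  have hmem : ∀ n ∈ orderSet 3, h.extension n ∈ Submodule.span ℂ (h.extension '' orderSet 3) :=
    fun n hn => Submodule.subset_span ⟨n, hn, rfl⟩
  have hz : ZSqStable (Submodule.span ℂ (h.extension '' orderSet 3)) := by
    intro f hf
    induction hf using Submodule.span_induction with
    | mem x hx =>
      obtain ⟨n, hn, rfl⟩ := hx
      rw [h.zvar_sq_mul_extension]
      exact hmem _ (add_two_mem_orderSet hn)
    | zero => simp
    | add x y _ _ hx hy => rw [mul_add]; exact add_mem hx hy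
    | smul c x _ hx =>
      rw [mul_comm, laurent_smul_mul, mul_comm]
      exact Submodule.smul_mem _ _ hx
  refine ⟨_, ⟨hz, setOf_hasOrder_span fun n _ => h.hasOrder_extension n⟩, ?_⟩
  have h3 : h.series i3 ∈ Submodule.span ℂ (h.extension '' orderSet 3) := by
    have := hmem 3 (Or.inl (by norm_num))
    rwa [Params.extension, if_pos (by norm_num), sub_self, zpowInt_zero, one_mul] at this
  have h4 : h.series i4 ∈ Submodule.span ℂ (h.extension '' orderSet 3) := by
    have := hmem 4 (Or.inl (by norm_num))
    rwa [Params.extension, if_neg (by norm_num), sub_self, zpowInt_zero, one_mul] at this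
  have hall : ∀ i : ℕ,
      h.series ⟨i + 3, by omega⟩ ∈ Submodule.span ℂ (h.extension '' orderSet 3) := by
    intro i
    induction i using Nat.twoStepInduction with
    | zero => exact h3
    | one => exact h4
    | more i hi _ =>
      have := hc.zvar_sq_mul_series ⟨i + 3, by omega⟩
      rw [show h.series ⟨i + 2 + 3, by omega⟩ = _ from eq_sub_of_add_eq this.symm]
      exact Submodule.sub_mem _ (hz _ hi) (Submodule.smul_mem _ _ h4)
  rw [Params.space, Submodule.span_le]
  rintro _ ⟨⟨j, hj⟩, rfl⟩
  obtain ⟨i, rfl⟩ := Nat.exists_eq_add_of_le' hj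
  exact hall i

/-! ### The number of solutions -/

/-- The solution of the linear recursion with given initial values. -/
def recSeq (a b c d : ℂ) : ℕ → ℂ × ℂ
  | 0 => (a, b)
  | 1 => (c, d)
  | i + 2 => ((recSeq a b c d i).2 - (recSeq a b c d i).1 * c, -((recSeq a b c d i).1 * d))

/-- The parameters with given `H^3_{-2}, H^3_0, H^4_{-2}, H^4_0`. -/
def Params.ofInitial (a b c d : ℂ) : Params where
  u j := (recSeq a b c d (j.1 - 3)).1
  v j := (recSeq a b c d (j.1 - 3)).2

theorem Params.Constraints.eq_ofInitial {h : Params} (hc : h.Constraints) :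
    h = Params.ofInitial (h.u i3) (h.v i3) (h.u i4) (h.v i4) := by
  have key : ∀ i : ℕ, recSeq (h.u i3) (h.v i3) (h.u i4) (h.v i4) i = (h.uNat i, h.vNat i) := by
    intro i
    induction i using Nat.twoStepInduction with
    | zero => rfl
    | one => rfl
    | more i hi _ => rw [recSeq, hi, hc.uNat_add_two, hc.vNat_add_two]; rfl
  ext j
  · obtain ⟨j, hj⟩ := j
    obtain ⟨i, rfl⟩ := Nat.exists_eq_add_of_le' hj
    simp only [ofInitial, Nat.add_sub_cancel, key]
    rfl
  · obtain ⟨j, hj⟩ := j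
    obtain ⟨i, rfl⟩ := Nat.exists_eq_add_of_le' hj
    simp only [ofInitial, Nat.add_sub_cancel, key]
    rfl

theorem Params.constraints_ofInitial {a b c d : ℂ} (h1 : d + 2 * b * a - a ^ 2 * c - c ^ 2 = 0)
    (h2 : b ^ 2 - a ^ 2 * d - c * d = 0) : (Params.ofInitial a b c d).Constraints := by
  refine ⟨?_, h1, h2⟩
  rintro ⟨j, hj⟩
  obtain ⟨i, rfl⟩ := Nat.exists_eq_add_of_le' hj
  simp only [ofInitial, Idx.plusTwo, i4]
  rw [show i + 3 + 2 - 3 = i + 2 by omega]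
  simp only [Nat.add_sub_cancel, recSeq, Nat.reduceSub]
  exact ⟨by ring, by ring⟩

theorem ncard_monic_quadratic (p q : ℂ) :
    {b : ℂ | b ^ 2 + p * b + q = 0}.ncard = 1 ∨ {b : ℂ | b ^ 2 + p * b + q = 0}.ncard = 2 := by
  obtain ⟨s, hs⟩ := IsAlgClosed.exists_pow_nat_eq (p ^ 2 - 4 * q) (n := 2) (by norm_num)
  have heq : {b : ℂ | b ^ 2 + p * b + q = 0} = {(-p + s) / 2, (-p - s) / 2} := by
    ext b
    simp only [Set.mem_ofPred_eq, Set.mem_insert_iff, Set.mem_singleton_iff]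
    rw [← sub_eq_zero (b := (-p + s) / 2), ← sub_eq_zero (b := (-p - s) / 2), ← mul_eq_zero]
    constructor
    · intro hb
      linear_combination hb - hs / 4
    · intro hb
      linear_combination hb + hs / 4
  rw [heq]
  by_cases hne : (-p + s) / 2 = (-p - s) / 2
  · left
    rw [hne, Set.pair_eq_singleton, Set.ncard_singleton]
  · right
    exact Set.ncard_pair hne

theorem ncard_constraints (α γ : ℂ) :
    {h : Params | h.Constraints ∧ h.u i3 = α ∧ h.u i4 = γ}.ncard = 1 ∨
      {h : Params | h.Constraints ∧ h.u i3 = α ∧ h.u i4 = γ}.ncard = 2 := by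
  -- The first nonlinear equation is linear in H^4_0 and determines it; substitution into the second
  -- leaves a monic quadratic in b = H^3_0.
  let f : ℂ → Params := fun b =>
    Params.ofInitial α b γ (α ^ 2 * γ + γ ^ 2 - 2 * b * α)
  have hf : Function.Injective f := fun b b' hbb => congrArg (fun h : Params => h.v i3) hbb
  have himg : {h : Params | h.Constraints ∧ h.u i3 = α ∧ h.u i4 = γ}
      = f '' {b : ℂ | b ^ 2 + (2 * α * (α ^ 2 + γ)) * b + (-(γ * (α ^ 2 + γ) ^ 2)) = 0} := by
    ext h
    constructor
    · rintro ⟨hc, rfl, rfl⟩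
      have hd : h.v i4 = h.u i3 ^ 2 * h.u i4 + h.u i4 ^ 2 - 2 * h.v i3 * h.u i3 := by
        linear_combination hc.2.1
      refine ⟨h.v i3, ?_, ?_⟩
      · have := hc.2.2
        rw [hd] at this
        simp only [Set.mem_ofPred_eq]
        linear_combination this
      · simp only [f]
        rw [← hd]
        exact hc.eq_ofInitial.symm
    · rintro ⟨b, hb, rfl⟩
      simp only [Set.mem_ofPred_eq] at hb
      exact ⟨Params.constraints_ofInitial (by ring) (by linear_combination hb), rfl, rfl⟩
  rw [himg, Set.ncard_image_of_injective _ hf]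
  exact ncard_monic_quadratic _ _

namespace Params

variable {h : Params}

/-! ### The algebra -/

theorem linearIndependent_series (h : Params) : LinearIndependent ℂ h.series :=
  h.isCanonical_series.linearIndependent

theorem not_finite_space (h : Params) : ¬ Module.Finite ℂ h.space := by
  intro hfin
  have : Infinite Idx := Infinite.of_injective (fun n : ℕ => (⟨n + 3, by omega⟩ : Idx))
    fun m n hmn => by simpa using hmn
  have hb := Module.Finite.finite_basis (R := ℂ) (M := h.space)
    (Module.Basis.span h.linearIndependent_series)
  exact not_finite Idx

theorem structConst_comm (h : Params) (j k : Idx) : h.structConst j k = h.structConst k j := by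
  have hjk : j.plus k = k.plus j := Subtype.ext (add_comm _ _)
  rw [structConst, structConst, hjk, mul_comm]
  abel

theorem linearCombination_series_injective (h : Params) :
    Function.Injective (Finsupp.linearCombination ℂ h.series) :=
  h.linearIndependent_series

/-- Associativity of the product of Laurent series, pulled back along the injective map from
coordinates to series. -/
theorem Constraints.structConst_assoc (hc : h.Constraints) (i j k : Idx) :
    ((h.structConst i j).sum fun s c => c • h.structConst s k) =
      (h.structConst j k).sum fun s c => c • h.structConst i s := by
  apply h.linearCombination_series_injective
  have key : ∀ j k : Idx,
      Finsupp.linearCombination ℂ h.series (h.structConst j k) = h.series j * h.series k :=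
    fun j k => (hc.series_mul_series j k).symm
  have hsum : ∀ (f : Idx →₀ ℂ) (g : Laurent),
      (f.sum fun s c => c • h.series s) * g = f.sum fun s c => c • (h.series s * g) := by
    intro f g
    simp only [Finsupp.sum, Finset.sum_mul, laurent_smul_mul]
  rw [map_finsuppSum, map_finsuppSum]
  simp only [map_smul, key]
  rw [← hsum, ← hc.series_mul_series, mul_assoc, hc.series_mul_series j k, mul_comm, hsum]
  simp only [mul_comm]

/-! ### The ideal of relations -/

theorem quadric_eq (h : Params) (j k : Idx) : h.quadric j k =
    MvPolynomial.X j * MvPolynomial.X k - (MvPolynomial.X (j.plus k)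
      + MvPolynomial.C (h.u k) * MvPolynomial.X j.plusTwo
      + MvPolynomial.C (h.v k) * MvPolynomial.X j
      + MvPolynomial.C (h.u j) * MvPolynomial.X k.plusTwo
      + MvPolynomial.C (h.v j) * MvPolynomial.X k
      + MvPolynomial.C (h.u j * h.u k) * MvPolynomial.X i4) := by
  have hsum : ((h.structConst j k).sum fun l c => MvPolynomial.C c * MvPolynomial.X l)
      = Finsupp.linearCombination ℂ (MvPolynomial.X : Idx → MvPolynomial Idx ℂ)
        (h.structConst j k) := by
    rw [Finsupp.linearCombination_apply]
    simp only [MvPolynomial.smul_eq_C_mul]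
  rw [quadric, hsum]
  simp only [structConst, map_add, Finsupp.linearCombination_single, MvPolynomial.smul_eq_C_mul,
    map_one, one_mul]

theorem Constraints.aeval_quadric (hc : h.Constraints) (j k : Idx) :
    MvPolynomial.aeval h.poly (h.quadric j k) = 0 := by
  rw [quadric_eq]
  simp only [map_sub, map_add, map_mul, MvPolynomial.aeval_X, MvPolynomial.algHom_C,
    Polynomial.algebraMap_eq]
  rw [hc.mul_eq Polynomial.C Polynomial.X (P := h.poly) (fun _ => rfl), map_mul]
  ring

theorem quadric_mem (h : Params) (j k : Idx) : h.quadric j k ∈ h.quadricIdeal :=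
  Ideal.subset_span ⟨j, k, rfl⟩

/-- Modulo the quadrics, every polynomial is equivalent to one of degree at most one. -/
theorem mem_quadricIdeal_sup_span (h : Params) (f : MvPolynomial Idx ℂ) :
    f ∈ h.quadricIdeal.restrictScalars ℂ ⊔
      Submodule.span ℂ (insert 1 (Set.range MvPolynomial.X)) := by
  set N := h.quadricIdeal.restrictScalars ℂ ⊔
    Submodule.span ℂ (insert (1 : MvPolynomial Idx ℂ) (Set.range MvPolynomial.X)) with hN
  have hI : ∀ f ∈ h.quadricIdeal, f ∈ N := fun f hf => Submodule.mem_sup_left hf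
  have h1 : (1 : MvPolynomial Idx ℂ) ∈ N :=
    Submodule.mem_sup_right (Submodule.subset_span (Set.mem_insert _ _))
  have hX : ∀ j : Idx, (MvPolynomial.X j : MvPolynomial Idx ℂ) ∈ N := fun j =>
    Submodule.mem_sup_right (Submodule.subset_span (Set.mem_insert_of_mem _ ⟨j, rfl⟩))
  have hCX : ∀ (c : ℂ) (j : Idx), (MvPolynomial.C c * MvPolynomial.X j : MvPolynomial Idx ℂ) ∈ N :=
    fun c j => by
      rw [← MvPolynomial.smul_eq_C_mul]
      exact N.smul_mem c (hX j)
  induction f using MvPolynomial.induction_on with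
  | C a =>
    rw [← mul_one (MvPolynomial.C a), ← MvPolynomial.smul_eq_C_mul]
    exact N.smul_mem a h1
  | add p q hp hq => exact N.add_mem hp hq
  | mul_X p k hp =>
    obtain ⟨y, hy, s, hs, rfl⟩ := Submodule.mem_sup.mp hp
    rw [add_mul]
    refine N.add_mem (hI _ (Ideal.mul_mem_right _ _ hy)) ?_
    clear hp
    induction hs using Submodule.span_induction with
    | mem x hx =>
      rcases hx with rfl | ⟨j, rfl⟩
      · rw [one_mul]; exact hX k
      · have hq := hI _ (h.quadric_mem j k)
        rw [quadric_eq] at hq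
        have hlin := N.add_mem (N.add_mem (N.add_mem (N.add_mem (N.add_mem (hX (j.plus k))
          (hCX (h.u k) j.plusTwo)) (hCX (h.v k) j)) (hCX (h.u j) k.plusTwo)) (hCX (h.v j) k))
          (hCX (h.u j * h.u k) i4)
        simpa using N.add_mem hq hlin
    | zero => simp
    | add x y _ _ hx hy => rw [add_mul]; exact N.add_mem hx hy
    | smul c x _ hx => rw [smul_mul_assoc]; exact N.smul_mem c hx

theorem coeff_poly (h : Params) (j l : Idx) :
    (h.poly j).coeff l.1 = if j = l then 1 else 0 := by
  have hl := l.2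
  have h2 : l.1 ≠ 2 := by omega
  have h0 : l.1 ≠ 0 := by omega
  simp [poly, Polynomial.coeff_X_pow, Polynomial.coeff_C, h2, h0, Subtype.ext_iff, eq_comm]

theorem Constraints.quadricIdeal_eq_ker (hc : h.Constraints) :
    h.quadricIdeal = RingHom.ker (MvPolynomial.aeval h.poly :
      MvPolynomial Idx ℂ →ₐ[ℂ] Polynomial ℂ) := by
  have hle : h.quadricIdeal ≤ RingHom.ker (MvPolynomial.aeval h.poly :
      MvPolynomial Idx ℂ →ₐ[ℂ] Polynomial ℂ) := by
    rw [quadricIdeal, Ideal.span_le]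
    rintro _ ⟨j, k, rfl⟩
    exact hc.aeval_quadric j k
  refine le_antisymm hle fun f hf => ?_
  obtain ⟨y, hy, s, hs, rfl⟩ := Submodule.mem_sup.mp (h.mem_quadricIdeal_sup_span f)
  have hs0 : MvPolynomial.aeval h.poly s = 0 := by
    have h1 := RingHom.mem_ker.mp hf
    have h2 := RingHom.mem_ker.mp (hle hy)
    rwa [map_add, h2, zero_add] at h1
  obtain ⟨c₀, t, ht, rfl⟩ := Submodule.mem_span_insert.mp hs
  obtain ⟨c, rfl⟩ := (Finsupp.mem_span_range_iff_exists_finsupp).mp ht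
  have hev : MvPolynomial.aeval h.poly
      (c₀ • (1 : MvPolynomial Idx ℂ) + c.sum fun i a => a • MvPolynomial.X i)
      = Polynomial.C c₀ + c.sum fun i a => a • h.poly i := by
    rw [map_add, map_smul, map_one, map_finsuppSum, Polynomial.smul_eq_C_mul, mul_one]
    simp
  rw [hev] at hs0
  -- The coefficient at z^l with l ≥ 3 isolates p_l, as neither the constant nor any other p_j
  -- contributes to it.
  have hc0 : c = 0 := by
    ext l
    have hl := congrArg (fun P => Polynomial.coeff P l.1) hs0
    have hl3 := l.2
    have hl0 : l.1 ≠ 0 := by omega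
    simp only [Polynomial.coeff_add, Polynomial.coeff_C, if_neg hl0, Finsupp.sum,
      Polynomial.finsetSum_coeff, Polynomial.coeff_smul, coeff_poly, smul_eq_mul, mul_ite, mul_one,
      mul_zero, zero_add, Polynomial.coeff_zero] at hl
    by_contra hne
    rw [Finset.sum_ite_eq' c.support l, if_pos (Finsupp.mem_support_iff.mpr hne)] at hl
    exact hne hl
  subst hc0
  simp only [Finsupp.sum_zero_index, add_zero] at hs0 ⊢
  rw [Polynomial.C_eq_zero.mp hs0, zero_smul, add_zero]
  exact hy

/-! ### The variety of the quadrics -/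

/-- The variable z is a root of the monic cubic T³ + H^3_{-2} T² + H^3_0 - p_3, and it generates
ℂ[z] over the constants. -/
theorem isIntegral_aeval_poly (h : Params) : ((MvPolynomial.aeval h.poly :
    MvPolynomial Idx ℂ →ₐ[ℂ] Polynomial ℂ) : MvPolynomial Idx ℂ →+* Polynomial ℂ).IsIntegral := by
  set φ : MvPolynomial Idx ℂ →+* Polynomial ℂ := ((MvPolynomial.aeval h.poly :
    MvPolynomial Idx ℂ →ₐ[ℂ] Polynomial ℂ) : MvPolynomial Idx ℂ →+* Polynomial ℂ) with hφ
  have hC : ∀ a : ℂ, φ (MvPolynomial.C a) = Polynomial.C a := fun a => by simp [hφ]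
  have hX : φ.IsIntegralElem Polynomial.X := by
    refine ⟨Polynomial.X ^ 3 + (Polynomial.C (MvPolynomial.C (h.u i3)) * Polynomial.X ^ 2
      + Polynomial.C (MvPolynomial.C (h.v i3) - MvPolynomial.X i3)), ?_, ?_⟩
    · refine Polynomial.monic_X_pow_add (lt_of_le_of_lt (b := 2) ?_ (by norm_num))
      compute_degree
    · have hX3 : φ (MvPolynomial.X i3) = h.poly i3 := by simp [hφ]
      simp only [Polynomial.eval₂_add, Polynomial.eval₂_mul, Polynomial.eval₂_pow,
        Polynomial.eval₂_X, Polynomial.eval₂_C, RingHom.map_sub φ, hC, hX3, poly]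
      simp only [i3]
      ring
  intro P
  induction P using Polynomial.induction_on' with
  | add p q hp hq => exact hp.add φ hq
  | monomial n a =>
    rw [← Polynomial.C_mul_X_pow_eq_monomial, ← hC]
    refine RingHom.IsIntegralElem.mul φ (φ.isIntegralElem_map) ?_
    induction n with
    | zero => rw [pow_zero, ← map_one φ]; exact φ.isIntegralElem_map
    | succ n ih => rw [pow_succ]; exact ih.mul φ hX

theorem Constraints.eval_quadric (hc : h.Constraints) (t : ℂ) (j k : Idx) :
    MvPolynomial.eval (fun j => (h.poly j).eval t) (h.quadric j k) = 0 := by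
  rw [quadric_eq]
  simp only [map_sub, map_add, map_mul, MvPolynomial.eval_X, MvPolynomial.eval_C]
  rw [hc.mul_eq (RingHom.id ℂ) t (P := fun j => (h.poly j).eval t) (fun _ => by simp [poly])]
  simp

theorem Constraints.zeroLocus_eq (hc : h.Constraints) :
    {x : Idx → ℂ | ∀ j k : Idx, MvPolynomial.eval x (h.quadric j k) = 0} =
      Set.range (fun (t : ℂ) (j : Idx) => (h.poly j).eval t) := by
  ext x
  constructor
  · intro hx
    let φ : MvPolynomial Idx ℂ →+* Polynomial ℂ := ((MvPolynomial.aeval h.poly :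
      MvPolynomial Idx ℂ →ₐ[ℂ] Polynomial ℂ) : MvPolynomial Idx ℂ →+* Polynomial ℂ)
    let _ : Algebra (MvPolynomial Idx ℂ) (Polynomial ℂ) := φ.toAlgebra
    have : Algebra.IsIntegral (MvPolynomial Idx ℂ) (Polynomial ℂ) := ⟨h.isIntegral_aeval_poly⟩
    have hsurj : Function.Surjective (MvPolynomial.eval x) :=
      fun c => ⟨MvPolynomial.C c, by simp⟩
    have : (RingHom.ker (MvPolynomial.eval x)).IsMaximal :=
      RingHom.ker_isMaximal_of_surjective _ hsurj
    have hker : RingHom.ker (algebraMap (MvPolynomial Idx ℂ) (Polynomial ℂ))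
        ≤ RingHom.ker (MvPolynomial.eval x) := by
      change RingHom.ker φ ≤ _
      have : RingHom.ker φ = h.quadricIdeal := hc.quadricIdeal_eq_ker.symm
      rw [this, quadricIdeal, Ideal.span_le]
      rintro _ ⟨j, k, rfl⟩
      exact hx j k
    -- Lying over: the maximal ideal of the zero x contains the kernel, so it is the contraction of
    -- a maximal ideal of ℂ[z], and a root of a generator of the latter is the parameter t.
    obtain ⟨Q, hQmax, hQ⟩ := Ideal.exists_ideal_over_maximal_of_isIntegral
      (RingHom.ker (MvPolynomial.eval x)) hker
    obtain ⟨g, rfl⟩ : ∃ g, Q = Ideal.span {g} :=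
      ⟨_, (Ideal.span_singleton_generator Q).symm⟩
    have hdeg : g.degree ≠ 0 := fun hg => hQmax.ne_top
      (Ideal.span_singleton_eq_top.mpr (Polynomial.isUnit_iff_degree_eq_zero.mpr hg))
    obtain ⟨t, ht⟩ := IsAlgClosed.exists_root g hdeg
    refine ⟨t, funext fun j => ?_⟩
    have hmem : MvPolynomial.X j - MvPolynomial.C (x j) ∈ RingHom.ker (MvPolynomial.eval x) := by
      simp [RingHom.mem_ker]
    rw [← hQ, Ideal.mem_comap] at hmem
    change φ _ ∈ _ at hmem
    obtain ⟨q, hq⟩ := Ideal.mem_span_singleton'.mp hmem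
    have hev := congrArg (Polynomial.eval t) hq
    simp only [Polynomial.eval_mul, ht.eq_zero, mul_zero, φ, map_sub, RingHom.coe_coe,
      MvPolynomial.aeval_X, MvPolynomial.algHom_C, Polynomial.algebraMap_eq, Polynomial.eval_sub,
      Polynomial.eval_C] at hev
    linear_combination -hev
  · rintro ⟨t, rfl⟩ j k
    exact hc.eval_quadric t j k

end Params

open Polynomial

/-! ### Regular differentials of a rational function field -/

/-- `z` is a transcendental generator of the field `K` over `ℂ`, so that `K = ℂ(z)`. -/
structure IsRationalGenerator {K : Type} [Field K] [Algebra ℂ K] (z : K) : Prop where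
  injective : Function.Injective (aeval z : ℂ[X] →ₐ[ℂ] K)
  exists_fraction : ∀ f : K, ∃ P Q : ℂ[X], Q ≠ 0 ∧ f * aeval z Q = aeval z P

namespace IsRationalGenerator

variable {K : Type} [Field K] [Algebra ℂ K] {z : K}

theorem aeval_ne_zero (hz : IsRationalGenerator z) {P : ℂ[X]} (hP : P ≠ 0) : aeval z P ≠ 0 :=
  (map_ne_zero_iff _ hz.injective).mpr hP

theorem ne_zero (hz : IsRationalGenerator z) : z ≠ 0 := by
  simpa using hz.aeval_ne_zero X_ne_zero

theorem exists_reduced_fraction (hz : IsRationalGenerator z) (f : K) :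
    ∃ P Q : ℂ[X], IsCoprime P Q ∧ Q ≠ 0 ∧ f * aeval z Q = aeval z P := by
  classical
  obtain ⟨P, Q, hQ, h⟩ := hz.exists_fraction f
  have hg : EuclideanDomain.gcd P Q ≠ 0 := fun h0 => hQ (EuclideanDomain.gcd_eq_zero_iff.mp h0).2
  obtain ⟨P', hP'⟩ := EuclideanDomain.gcd_dvd_left P Q
  obtain ⟨Q', hQ'⟩ := EuclideanDomain.gcd_dvd_right P Q
  set g := EuclideanDomain.gcd P Q with hgdef
  refine ⟨P', Q', ?_, ?_, ?_⟩
  · refine ⟨EuclideanDomain.gcdA P Q, EuclideanDomain.gcdB P Q, mul_left_cancel₀ hg ?_⟩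
    have hb := EuclideanDomain.gcd_eq_gcd_ab P Q
    rw [← hgdef] at hb
    conv_rhs => rw [mul_one, hb]
    linear_combination (-EuclideanDomain.gcdA P Q) * hP' - EuclideanDomain.gcdB P Q * hQ'
  · rintro rfl
    exact hQ (by rw [hQ', mul_zero])
  · rw [hP', hQ', map_mul, map_mul] at h
    exact mul_left_cancel₀ (hz.aeval_ne_zero hg) (by rw [← h]; ring)

/-- The local ring of `ℂ(z)` at the place `z = t`. -/
def place (hz : IsRationalGenerator z) (t : ℂ) : ValuationSubring K where
  carrier := {f | ∃ P Q : ℂ[X], Q.eval t ≠ 0 ∧ f * aeval z Q = aeval z P}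
  mul_mem' := by
    rintro f g ⟨P, Q, hQ, h⟩ ⟨P', Q', hQ', h'⟩
    refine ⟨P * P', Q * Q', by rw [eval_mul]; exact mul_ne_zero hQ hQ', ?_⟩
    rw [map_mul, map_mul, ← h, ← h']
    ring
  one_mem' := ⟨1, 1, by simp, by simp⟩
  add_mem' := by
    rintro f g ⟨P, Q, hQ, h⟩ ⟨P', Q', hQ', h'⟩
    refine ⟨P * Q' + P' * Q, Q * Q', by rw [eval_mul]; exact mul_ne_zero hQ hQ', ?_⟩
    rw [map_add, map_mul, map_mul, map_mul, ← h, ← h']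
    ring
  zero_mem' := ⟨0, 1, by simp, by simp⟩
  neg_mem' := by
    rintro f ⟨P, Q, hQ, h⟩
    exact ⟨-P, Q, hQ, by rw [map_neg, ← h]; ring⟩
  mem_or_inv_mem' f := by
    obtain ⟨P, Q, hPQ, hQ0, h⟩ := hz.exists_reduced_fraction f
    by_cases hQ : Q.eval t = 0
    · right
      have hP : P.eval t ≠ 0 := by
        intro hP
        obtain ⟨A, B, hAB⟩ := hPQ
        have := congrArg (eval t) hAB
        simp [hP, hQ] at this
      have hf : f ≠ 0 := by
        rintro rfl
        have hP0 : P = 0 := by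
          by_contra hP0
          exact hz.aeval_ne_zero hP0 (by rw [← h, zero_mul])
        exact hP (by rw [hP0, eval_zero])
      exact ⟨Q, P, hP, by rw [← h, inv_mul_cancel_left₀ hf]⟩
    · exact Or.inl ⟨P, Q, hQ, h⟩

theorem mem_place {hz : IsRationalGenerator z} {t : ℂ} {f : K} :
    f ∈ hz.place t ↔ ∃ P Q : ℂ[X], Q.eval t ≠ 0 ∧ f * aeval z Q = aeval z P := Iff.rfl

theorem aeval_mem_place (hz : IsRationalGenerator z) (t : ℂ) (P : ℂ[X]) :
    aeval z P ∈ hz.place t := ⟨P, 1, by simp, by simp⟩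

theorem algebraMap_mem_place (hz : IsRationalGenerator z) (t c : ℂ) :
    algebraMap ℂ K c ∈ hz.place t := by
  simpa using hz.aeval_mem_place t (C c)

theorem inv_aeval_mem_place (hz : IsRationalGenerator z) {t : ℂ} {Q : ℂ[X]} (hQ : Q.eval t ≠ 0) :
    (aeval z Q)⁻¹ ∈ hz.place t := by
  have hQ0 : Q ≠ 0 := by
    rintro rfl
    simp at hQ
  exact ⟨1, Q, hQ, by rw [inv_mul_cancel₀ (hz.aeval_ne_zero hQ0), map_one]⟩

/-- A function without poles at finite distance is a polynomial. -/
theorem exists_aeval_eq (hz : IsRationalGenerator z) {f : K} (hf : ∀ t, f ∈ hz.place t) :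
    ∃ P : ℂ[X], aeval z P = f := by
  obtain ⟨P, Q, ⟨A, B, hAB⟩, hQ0, h⟩ := hz.exists_reduced_fraction f
  have hroot : ∀ t, Q.eval t ≠ 0 := by
    intro t ht
    obtain ⟨P', Q', hQ', h'⟩ := mem_place.mp (hf t)
    have heq : P * Q' = P' * Q := by
      apply hz.injective
      rw [map_mul, map_mul, ← h, ← h']
      ring
    have h1 := congrArg (eval t) heq
    have h2 := congrArg (eval t) hAB
    rw [eval_mul, eval_mul, ht, mul_zero] at h1
    have hP := (mul_eq_zero.mp h1).resolve_right hQ'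
    simp [hP, ht] at h2
  have hdeg : Q.degree = 0 := by
    by_contra hd
    obtain ⟨t, ht⟩ := IsAlgClosed.exists_root Q hd
    exact hroot t ht
  obtain ⟨c, hc, hcQ⟩ := Polynomial.isUnit_iff.mp (Polynomial.isUnit_iff_degree_eq_zero.mpr hdeg)
  have hc0 : algebraMap ℂ K c ≠ 0 := by
    have := hz.aeval_ne_zero hQ0
    rwa [← hcQ, aeval_C] at this
  refine ⟨C c⁻¹ * P, ?_⟩
  rw [map_mul, ← h, ← hcQ, aeval_C, aeval_C, map_inv₀]
  field_simp

/-- The derivation `d/dz` as a functional on differentials. -/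
theorem exists_functional (hz : IsRationalGenerator z) :
    ∃ φ : KaehlerDifferential ℂ K →ₗ[K] K, φ (KaehlerDifferential.D ℂ K z) = 1 := by
  let _ : Algebra ℂ[X] K := (aeval z : ℂ[X] →ₐ[ℂ] K).toRingHom.toAlgebra
  have halg : ∀ P : ℂ[X], algebraMap ℂ[X] K P = aeval z P := fun _ => rfl
  have : IsScalarTower ℂ ℂ[X] K := IsScalarTower.of_algebraMap_eq fun c => by
    rw [halg, Polynomial.algebraMap_eq, aeval_C]
  have : IsFractionRing ℂ[X] K := by
    refine ⟨?_, ?_, ?_⟩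
    · rintro ⟨Q, hQ⟩
      exact (hz.aeval_ne_zero (nonZeroDivisors.ne_zero hQ)).isUnit
    · intro f
      obtain ⟨P, Q, hQ, h⟩ := hz.exists_fraction f
      exact ⟨⟨P, ⟨Q, mem_nonZeroDivisors_of_ne_zero hQ⟩⟩, h⟩
    · intro P Q hPQ
      exact ⟨1, by rw [hz.injective hPQ]⟩
  -- Localization is formally étale, so the differentials of K are the base change of those of ℂ[X],
  -- which are free on dX.
  have : Algebra.FormallyEtale ℂ[X] K :=
    Algebra.FormallyEtale.of_isLocalization (nonZeroDivisors ℂ[X])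
  let e := KaehlerDifferential.tensorKaehlerEquivOfFormallyEtale ℂ ℂ[X] K
  let ψ : TensorProduct ℂ[X] K (KaehlerDifferential ℂ ℂ[X]) →ₗ[K] K :=
    (TensorProduct.AlgebraTensorModule.rid ℂ[X] K K).toLinearMap ∘ₗ
      TensorProduct.AlgebraTensorModule.map LinearMap.id
        (KaehlerDifferential.polynomialEquiv ℂ).toLinearMap
  refine ⟨ψ ∘ₗ e.symm.toLinearMap, ?_⟩
  have hzX : z = algebraMap ℂ[X] K X := by rw [halg, aeval_X]
  have := KaehlerDifferential.tensorKaehlerEquivOfFormallyEtale_symm_D_algebraMap ℂ ℂ[X] K X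
  rw [← hzX] at this
  simp only [LinearMap.comp_apply, LinearEquiv.coe_coe, e, this, ψ]
  simp

/-- The quotient rule, obtained by differentiating f Q(z) = P(z). -/
theorem D_eq (hz : IsRationalGenerator z) {f : K} {P Q : ℂ[X]} (hQ : Q ≠ 0)
    (h : f * aeval z Q = aeval z P) : KaehlerDifferential.D ℂ K f =
      ((aeval z Q)⁻¹ * (aeval z (derivative P) - f * aeval z (derivative Q))) •
        KaehlerDifferential.D ℂ K z := by
  have hQz := hz.aeval_ne_zero hQ
  have h1 := congrArg (KaehlerDifferential.D ℂ K) h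
  rw [Derivation.leibniz, Derivation.map_aeval, Derivation.map_aeval, smul_smul] at h1
  have h2 : aeval z Q • KaehlerDifferential.D ℂ K f =
      (aeval z (derivative P) - f * aeval z (derivative Q)) • KaehlerDifferential.D ℂ K z := by
    rw [sub_smul, ← h1]
    abel
  rw [mul_smul, ← h2, smul_smul, inv_mul_cancel₀ hQz, one_smul]

theorem functional_smul_D (hz : IsRationalGenerator z) {φ : KaehlerDifferential ℂ K →ₗ[K] K}
    (hφ : φ (KaehlerDifferential.D ℂ K z) = 1) (w : KaehlerDifferential ℂ K) :
    w = φ w • KaehlerDifferential.D ℂ K z := by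
  have hw : w ∈ Submodule.span K (Set.range (KaehlerDifferential.D ℂ K)) := by
    rw [KaehlerDifferential.span_range_derivation]
    trivial
  induction hw using Submodule.span_induction with
  | mem x hx =>
    obtain ⟨f, rfl⟩ := hx
    obtain ⟨P, Q, hQ, h⟩ := hz.exists_fraction f
    rw [hz.D_eq hQ h, map_smul, hφ, smul_eq_mul, mul_one]
  | zero => simp
  | add x y _ _ hx hy => rw [map_add, add_smul, ← hx, ← hy]
  | smul c x _ hx => rw [map_smul, smul_eq_mul, mul_smul, ← hx]

/-- A regular differential is of the form `P(z) dz` with a polynomial `P`. -/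
theorem exists_functional_eq_aeval (hz : IsRationalGenerator z)
    {φ : KaehlerDifferential ℂ K →ₗ[K] K} (hφ : φ (KaehlerDifferential.D ℂ K z) = 1)
    {w : KaehlerDifferential ℂ K} (hw : w ∈ regularDifferentials K) :
    ∃ P : ℂ[X], aeval z P = φ w := by
  refine hz.exists_aeval_eq fun t => ?_
  have hwt := (Submodule.mem_iInf _).mp hw ⟨hz.place t, hz.algebraMap_mem_place t⟩
  simp only at hwt
  clear hw
  induction hwt using Submodule.span_induction with
  | mem x hx =>
    obtain ⟨f, hf, g, hg, rfl⟩ := hx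
    obtain ⟨P, Q, hQ, h⟩ := mem_place.mp hg
    have hQ0 : Q ≠ 0 := by
      rintro rfl
      simp at hQ
    rw [hz.D_eq hQ0 h, map_smul, map_smul, hφ, smul_eq_mul, smul_eq_mul, mul_one]
    exact mul_mem hf (mul_mem (hz.inv_aeval_mem_place hQ)
      (sub_mem (hz.aeval_mem_place t _) (mul_mem hg (hz.aeval_mem_place t _))))
  | zero => rw [map_zero]; exact zero_mem _
  | add x y _ _ hx hy => rw [map_add]; exact add_mem hx hy
  | smul c x _ hx =>
    rw [← algebraMap_smul K c x, map_smul, smul_eq_mul]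
    exact mul_mem (hz.algebraMap_mem_place t c) hx

theorem aeval_inv_mul_pow (hz0 : z ≠ 0) (P : ℂ[X]) :
    aeval z⁻¹ P * z ^ P.natDegree = aeval z P.reverse := by
  let _ : Invertible z⁻¹ := invertibleOfNonzero (inv_ne_zero hz0)
  have h := eval₂_reverse_mul_pow (algebraMap ℂ K) z⁻¹ P
  rw [invOf_eq_inv, inv_inv] at h
  rw [aeval_def, aeval_def, ← h, mul_assoc, ← mul_pow, inv_mul_cancel₀ hz0, one_pow, mul_one]

/-- Passing to 1/z reverses polynomials. Using both generators brings in the place at infinity. -/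
theorem inv (hz : IsRationalGenerator z) : IsRationalGenerator z⁻¹ where
  injective := by
    rw [injective_iff_map_eq_zero]
    intro P hP
    have h := aeval_inv_mul_pow hz.ne_zero P
    rw [hP, zero_mul] at h
    rw [← reverse_eq_zero]
    by_contra hne
    exact hz.aeval_ne_zero hne h.symm
  exists_fraction f := by
    have key : ∀ P : ℂ[X], aeval z P = z ^ P.natDegree * aeval z⁻¹ P.reverse := by
      intro P
      have h := aeval_inv_mul_pow (inv_ne_zero hz.ne_zero) P
      rw [inv_inv] at h
      rw [← h, mul_comm, mul_assoc, ← mul_pow, inv_mul_cancel₀ hz.ne_zero, one_pow, mul_one]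
    obtain ⟨P, Q, hQ, h⟩ := hz.exists_fraction f
    rw [key, key] at h
    refine ⟨P.reverse * X ^ Q.natDegree, Q.reverse * X ^ P.natDegree, ?_, ?_⟩
    · exact mul_ne_zero (by rwa [ne_eq, reverse_eq_zero]) (pow_ne_zero _ X_ne_zero)
    · have hz0 := hz.ne_zero
      simp only [map_mul, map_pow, aeval_X, inv_pow]
      generalize aeval z⁻¹ P.reverse = p at h ⊢
      generalize aeval z⁻¹ Q.reverse = q at h ⊢
      field_simp
      linear_combination h

/-- The field `ℂ(z)` has no nonzero regular differentials. -/
theorem regularDifferentials_eq_bot (hz : IsRationalGenerator z) : regularDifferentials K = ⊥ := by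
  rw [eq_bot_iff]
  intro w hw
  obtain ⟨φ, hφ⟩ := hz.exists_functional
  obtain ⟨φ', hφ'⟩ := hz.inv.exists_functional
  obtain ⟨P, hP⟩ := hz.exists_functional_eq_aeval hφ hw
  obtain ⟨R, hR⟩ := hz.inv.exists_functional_eq_aeval hφ' hw
  have hz0 := hz.ne_zero
  have hDz : φ' (KaehlerDifferential.D ℂ K z) = -z ^ 2 := by
    have h := (KaehlerDifferential.D ℂ K).leibniz_of_mul_eq_one (mul_inv_cancel₀ hz0)
    rw [h, map_smul, hφ', smul_eq_mul, mul_one]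
  have hw' := hz.functional_smul_D hφ w
  -- From dz = -z² d(1/z), comparing P(z) dz with R(1/z) d(1/z).
  have hrel : aeval z⁻¹ R = -(z ^ 2 * aeval z P) := by
    rw [hR, hw', map_smul, hDz, ← hP, smul_eq_mul]
    ring
  have hpoly : R.reverse = -(X ^ (R.natDegree + 2) * P) := by
    apply hz.injective
    rw [← aeval_inv_mul_pow hz0, hrel]
    simp only [map_neg, map_mul, map_pow, aeval_X]
    ring
  -- The reverse of R has degree at most deg R, whereas the other side has degree at least deg R + 2
  -- unless P = 0.
  have hP0 : P = 0 := by
    by_contra hne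
    have hd := R.reverse_natDegree_le
    rw [hpoly, natDegree_neg, natDegree_mul (pow_ne_zero _ X_ne_zero) hne, natDegree_X_pow] at hd
    omega
  rw [Submodule.mem_bot, hw', ← hP, hP0, map_zero, zero_smul]

end IsRationalGenerator

/-! ### The plane curve -/

namespace Params

variable {h : Params}

/-- The parametrisation `z ↦ (p_3(z), p_4(z))` of the plane curve. -/
def param (h : Params) : MvPolynomial (Fin 2) ℂ →ₐ[ℂ] ℂ[X] :=
  MvPolynomial.aeval ![h.poly i3, h.poly i4]

theorem param_X_zero (h : Params) : h.param (MvPolynomial.X 0) = h.poly i3 := by simp [param]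

theorem param_X_one (h : Params) : h.param (MvPolynomial.X 1) = h.poly i4 := by simp [param]

theorem param_C (h : Params) (c : ℂ) : h.param (MvPolynomial.C c) = C c := by simp [param]

theorem poly_i3 (h : Params) : h.poly i3 = X ^ 3 + C (h.u i3) * X ^ 2 + C (h.v i3) := rfl

theorem poly_i4 (h : Params) : h.poly i4 = X ^ 4 + C (h.u i4) * X ^ 2 + C (h.v i4) := rfl

theorem Constraints.param_curve (hc : h.Constraints) : h.param h.curve = 0 := by
  have hd : C (h.v i4) = C (h.u i3) ^ 2 * C (h.u i4) + C (h.u i4) ^ 2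
      - 2 * C (h.v i3) * C (h.u i3) := by
    have := congrArg (C : ℂ →+* ℂ[X]) hc.2.1
    simp only [map_add, map_sub, map_mul, map_pow, map_zero, map_ofNat] at this
    linear_combination this
  have hb : C (h.v i3) ^ 2 - C (h.u i3) ^ 2 * C (h.v i4) - C (h.u i4) * C (h.v i4) = 0 := by
    have := congrArg (C : ℂ →+* ℂ[X]) hc.2.2
    simpa only [map_add, map_sub, map_mul, map_pow, map_zero, map_ofNat] using this
  simp only [curve, map_add, map_sub, map_mul, map_pow, map_neg, map_ofNat, param_X_zero,
    param_X_one, param_C, poly_i3, poly_i4]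
  rw [hd] at hb ⊢
  generalize C (h.u i3) = a at hb ⊢
  generalize C (h.v i3) = b at hb ⊢
  generalize C (h.u i4) = c at hb ⊢
  -- Once d is eliminated, F(p_3, p_4) no longer involves z: it is the square of the second
  -- nonlinear constraint, and the cofactor is that constraint expanded.
  linear_combination (-a ^ 4 * c + 2 * a ^ 3 * b - 2 * a ^ 2 * c ^ 2 + 2 * a * b * c + b ^ 2
    - c ^ 3) * hb

theorem Constraints.rename_curve_mem (hc : h.Constraints) :
    MvPolynomial.rename ![i3, i4] h.curve ∈ h.quadricIdeal := by
  rw [hc.quadricIdeal_eq_ker, RingHom.mem_ker]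
  have hcomp : h.poly ∘ ![i3, i4] = ![h.poly i3, h.poly i4] := by
    funext i
    fin_cases i <;> rfl
  change MvPolynomial.aeval h.poly (MvPolynomial.rename ![i3, i4] h.curve) = 0
  rw [MvPolynomial.aeval_rename, hcomp]
  exact hc.param_curve

/-- The equation of the curve as a monic polynomial in `y`. -/
theorem exists_curve_eq (h : Params) : ∃ e₁₂ e₂₁ e₃₀ e₀₂ e₁₁ e₂₀ e₀₁ e₁₀ : ℂ,
    h.curve = MvPolynomial.X 1 ^ 3 - MvPolynomial.X 0 ^ 4
      + (MvPolynomial.C e₁₂ * (MvPolynomial.X 0 ^ 1 * MvPolynomial.X 1 ^ 2)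
      + MvPolynomial.C e₂₁ * (MvPolynomial.X 0 ^ 2 * MvPolynomial.X 1 ^ 1)
      + MvPolynomial.C e₃₀ * (MvPolynomial.X 0 ^ 3 * MvPolynomial.X 1 ^ 0)
      + MvPolynomial.C e₀₂ * (MvPolynomial.X 0 ^ 0 * MvPolynomial.X 1 ^ 2)
      + MvPolynomial.C e₁₁ * (MvPolynomial.X 0 ^ 1 * MvPolynomial.X 1 ^ 1)
      + MvPolynomial.C e₂₀ * (MvPolynomial.X 0 ^ 2 * MvPolynomial.X 1 ^ 0)
      + MvPolynomial.C e₀₁ * (MvPolynomial.X 0 ^ 0 * MvPolynomial.X 1 ^ 1)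
      + MvPolynomial.C e₁₀ * (MvPolynomial.X 0 ^ 1 * MvPolynomial.X 1 ^ 0)) := by
  let a := h.u i3
  let b := h.v i3
  let c := h.u i4
  let d := h.v i4
  refine ⟨4 * a, -(3 * c - 2 * a ^ 2), -(-4 * b + 2 * a * c),
    -(3 * d + 4 * b * a + a ^ 4 + a ^ 2 * c),
    -(4 * a ^ 2 * b + 8 * a * d - 2 * a * c ^ 2 - 6 * b * c - 2 * a ^ 3 * c),
    -(-3 * d * c + 6 * b ^ 2 - 6 * b * a * c + 2 * a ^ 2 * d + a ^ 2 * c ^ 2 + c ^ 3),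
    -(-3 * d ^ 2 - 2 * b ^ 2 * a ^ 2 - 2 * a ^ 2 * d * c - 2 * a ^ 4 * d + 3 * b ^ 2 * c
        + 2 * b * a * c ^ 2 - 8 * b * a * d + 2 * b * a ^ 3 * c),
    -(-4 * b ^ 3 - 4 * a * d ^ 2 + 6 * b * d * c - 4 * b * d * a ^ 2 + 6 * b ^ 2 * a * c
        + 2 * d * a * c ^ 2 + 2 * d * a ^ 3 * c - 2 * b * a ^ 2 * c ^ 2 - 2 * b * c ^ 3), ?_⟩
  simp only [curve, map_add, map_sub, map_mul, map_pow, map_neg, map_ofNat, a, b, c, d]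
  ring

theorem isNSCurve_curve (h : Params) : IsNSCurve 3 4 h.curve := by
  refine ⟨by norm_num, ?_⟩
  obtain ⟨e₁₂, e₂₁, e₃₀, e₀₂, e₁₁, e₂₀, e₀₁, e₁₀, he⟩ := h.exists_curve_eq
  rw [he, add_sub_cancel_left]
  let N : Submodule ℂ (MvPolynomial (Fin 2) ℂ) :=
    MvPolynomial.restrictSupport ℂ {m | 3 * m 0 + 4 * m 1 < 3 * 4}
  have hmon : ∀ (e : ℂ) (i j : ℕ), 3 * i + 4 * j < 3 * 4 →
      MvPolynomial.C e * (MvPolynomial.X 0 ^ i * MvPolynomial.X 1 ^ j) ∈ N := by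
    intro e i j hij m hm
    rw [MvPolynomial.X_pow_eq_monomial, MvPolynomial.X_pow_eq_monomial, MvPolynomial.monomial_mul,
      MvPolynomial.C_mul_monomial] at hm
    have := Finset.mem_singleton.mp (MvPolynomial.support_monomial_subset hm)
    subst this
    simpa using hij
  have hsum := N.add_mem (N.add_mem (N.add_mem (N.add_mem (N.add_mem (N.add_mem (N.add_mem
    (hmon e₁₂ 1 2 (by norm_num)) (hmon e₂₁ 2 1 (by norm_num))) (hmon e₃₀ 3 0 (by norm_num)))
    (hmon e₀₂ 0 2 (by norm_num))) (hmon e₁₁ 1 1 (by norm_num))) (hmon e₂₀ 2 0 (by norm_num)))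
    (hmon e₀₁ 0 1 (by norm_num))) (hmon e₁₀ 1 0 (by norm_num))
  exact fun m hm => hsum hm

/-- Modulo the equation of the curve, every polynomial has degree at most two in `y`. -/
theorem exists_normal_form (h : Params) (f : MvPolynomial (Fin 2) ℂ) : ∃ A : Fin 3 → ℂ[X],
    f - ∑ i, aeval (MvPolynomial.X 0 : MvPolynomial (Fin 2) ℂ) (A i) * MvPolynomial.X 1 ^ i.1
      ∈ Ideal.span {h.curve} := by
  obtain ⟨q₀, q₁, q₂, hq⟩ : ∃ q₀ q₁ q₂ : ℂ[X], h.curve = MvPolynomial.X 1 ^ 3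
      + aeval (MvPolynomial.X 0) q₂ * MvPolynomial.X 1 ^ 2
      + aeval (MvPolynomial.X 0) q₁ * MvPolynomial.X 1 + aeval (MvPolynomial.X 0) q₀ := by
    obtain ⟨e₁₂, e₂₁, e₃₀, e₀₂, e₁₁, e₂₀, e₀₁, e₁₀, he⟩ := h.exists_curve_eq
    refine ⟨-X ^ 4 + C e₃₀ * X ^ 3 + C e₂₀ * X ^ 2 + C e₁₀ * X,
      C e₂₁ * X ^ 2 + C e₁₁ * X + C e₀₁, C e₁₂ * X + C e₀₂, ?_⟩
    rw [he]
    simp only [map_add, map_mul, map_pow, map_neg, aeval_X, aeval_C, MvPolynomial.algebraMap_eq]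
    ring
  induction f using MvPolynomial.induction_on with
  | C c =>
    refine ⟨![C c, 0, 0], ?_⟩
    simp [Fin.sum_univ_three]
  | add p q hp hq =>
    obtain ⟨A, hA⟩ := hp
    obtain ⟨B, hB⟩ := hq
    refine ⟨A + B, ?_⟩
    convert Ideal.add_mem _ hA hB using 1
    simp only [Fin.sum_univ_three, Pi.add_apply, map_add]
    ring
  | mul_X p n hp =>
    obtain ⟨A, hA⟩ := hp
    have hA' := Ideal.mul_mem_right (MvPolynomial.X n) _ hA
    fin_cases n
    · refine ⟨fun i => A i * X, ?_⟩
      convert hA' using 1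
      simp only [Fin.sum_univ_three, map_mul, aeval_X, Fin.zero_eta]
      ring
    · refine ⟨![-(A 2 * q₀), A 0 - A 2 * q₁, A 1 - A 2 * q₂], ?_⟩
      have hF := Ideal.mul_mem_left (Ideal.span {h.curve})
        (aeval (MvPolynomial.X 0 : MvPolynomial (Fin 2) ℂ) (A 2))
        (Ideal.mem_span_singleton_self h.curve)
      convert Ideal.add_mem _ hA' hF using 1
      rw [hq]
      simp only [Fin.sum_univ_three, Matrix.cons_val_zero, Matrix.cons_val_one, Matrix.cons_val,
        map_mul, map_sub, map_neg, Fin.mk_one, Fin.val_zero, Fin.val_one, Fin.val_two]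
      ring

/-! ### The kernel of the parametrisation and rationality of the function field. -/

theorem natDegree_poly_i3 (h : Params) : (h.poly i3).natDegree = 3 := by
  rw [poly_i3]
  compute_degree!

theorem natDegree_poly_i4 (h : Params) : (h.poly i4).natDegree = 4 := by
  rw [poly_i4]
  compute_degree!

/-- A nonzero i-th term has degree 3 deg A_i + 4 i, congruent to i modulo 3. The degrees are
distinct, so nothing cancels. -/
theorem eq_zero_of_sum_comp_eq_zero (h : Params) {A : Fin 3 → ℂ[X]}
    (hA : ∑ i, (A i).comp (h.poly i3) * h.poly i4 ^ i.1 = 0) : A = 0 := by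
  have h4 : h.poly i4 ≠ 0 := fun h0 => by simpa [h0] using h.natDegree_poly_i4
  have hcomp : ∀ P : ℂ[X], P.comp (h.poly i3) = 0 → P = 0 := by
    intro P hP
    rcases comp_eq_zero_iff.mp hP with h0 | ⟨-, h1⟩
    · exact h0
    · have := h.natDegree_poly_i3
      rw [h1, natDegree_C] at this
      omega
  have hdeg : ∀ i, (A i).comp (h.poly i3) * h.poly i4 ^ i.1 ≠ 0 →
      ((A i).comp (h.poly i3) * h.poly i4 ^ i.1).natDegree = (A i).natDegree * 3 + i.1 * 4 := by
    intro i hi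
    rw [natDegree_mul (left_ne_zero_of_mul hi) (right_ne_zero_of_mul hi), natDegree_comp,
      natDegree_pow, h.natDegree_poly_i3, h.natDegree_poly_i4]
  have hpair := degree_sum_eq_of_disjoint
    (fun i : Fin 3 => (A i).comp (h.poly i3) * h.poly i4 ^ i.1) Finset.univ (by
      rintro i ⟨-, hi⟩ j ⟨-, hj⟩ hij hd
      have hn := natDegree_eq_of_degree_eq hd
      simp only at hi hj hn
      rw [hdeg i hi, hdeg j hj] at hn
      exact hij (Fin.ext (by omega)))
  rw [hA, degree_zero] at hpair
  funext i
  have hi : degree ((A i).comp (h.poly i3) * h.poly i4 ^ i.1) ≤ ⊥ := by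
    rw [hpair]
    exact Finset.le_sup (f := fun i : Fin 3 => degree ((A i).comp (h.poly i3) * h.poly i4 ^ i.1))
      (Finset.mem_univ i)
  rw [le_bot_iff, degree_eq_bot] at hi
  exact hcomp _ ((mul_eq_zero.mp hi).resolve_right (pow_ne_zero _ h4))

theorem Constraints.span_curve_eq_ker (hc : h.Constraints) :
    Ideal.span {h.curve} = RingHom.ker h.param := by
  have hle : Ideal.span {h.curve} ≤ RingHom.ker h.param := by
    rw [Ideal.span_singleton_le_iff_mem]
    exact hc.param_curve
  refine le_antisymm hle fun f hf => ?_
  obtain ⟨A, hA⟩ := h.exists_normal_form f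
  have h0 := hle hA
  have haev : ∀ P : ℂ[X], h.param (aeval (MvPolynomial.X 0) P) = P.comp (h.poly i3) := by
    intro P
    rw [← aeval_algHom_apply, param_X_zero, comp_eq_aeval]
  rw [RingHom.mem_ker, map_sub, RingHom.mem_ker.mp hf, zero_sub, neg_eq_zero, map_sum] at h0
  simp only [map_mul, map_pow, haev, param_X_one] at h0
  rw [h.eq_zero_of_sum_comp_eq_zero h0] at hA
  simpa using hA

theorem Constraints.isPrime_span_curve (hc : h.Constraints) : (Ideal.span {h.curve}).IsPrime := by
  rw [hc.span_curve_eq_ker]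
  exact RingHom.ker_isPrime _

/-- The coordinate `z` is a rational function on the curve. -/
theorem exists_param_eq_X_mul (h : Params) :
    ∃ β γ : MvPolynomial (Fin 2) ℂ, h.param γ ≠ 0 ∧ h.param β = X * h.param γ := by
  let x : MvPolynomial (Fin 2) ℂ := MvPolynomial.X 0 - MvPolynomial.C (h.v i3)
  let y : MvPolynomial (Fin 2) ℂ := MvPolynomial.X 1 - MvPolynomial.C (h.v i4)
  let a : MvPolynomial (Fin 2) ℂ := MvPolynomial.C (h.u i3)
  let c : MvPolynomial (Fin 2) ℂ := MvPolynomial.C (h.u i4)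
  have hγ : h.param (x ^ 2 + (a ^ 2 + c) * y) = X ^ 6 + C (2 * h.u i3) * X ^ 5
      + C (2 * h.u i3 ^ 2 + h.u i4) * X ^ 4 + C ((h.u i3 ^ 2 + h.u i4) * h.u i4) * X ^ 2 := by
    simp only [x, y, a, c, map_add, map_sub, map_mul, map_pow, map_ofNat, param_X_zero,
      param_X_one, param_C, poly_i3, poly_i4]
    ring
  -- With x = z³ + a z² and y = z⁴ + c z², the product x y + a x² agrees with z x² in degrees 7 and
  -- 6. The z⁵ coefficients differ by a² + c, whence the term (a² + c) y in γ; multiples of y and x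
  -- then correct z⁴ and z³, and z² cancels.
  refine ⟨x * y + a * x ^ 2 - a * (a ^ 2 + c) * y + c * (a ^ 2 + c) * x,
    x ^ 2 + (a ^ 2 + c) * y, ?_, ?_⟩
  · rw [hγ]
    refine Monic.ne_zero ?_
    monicity!
  · simp only [x, y, a, c, map_add, map_sub, map_mul, map_pow, param_X_zero, param_X_one, param_C,
      poly_i3, poly_i4]
    ring

/-- The parametrisation embeds the function field into ℂ(z), and the quotient β/γ maps to z.
Numerators and denominators are pulled back by injectivity. -/
theorem Constraints.exists_isRationalGenerator (hc : h.Constraints)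
    [(Ideal.span {h.curve}).IsPrime] : ∃ z : FractionRing
      (MvPolynomial (Fin 2) ℂ ⧸ Ideal.span {h.curve}), IsRationalGenerator z := by
  let Q := MvPolynomial (Fin 2) ℂ ⧸ Ideal.span {h.curve}
  let K := FractionRing Q
  have hker := hc.span_curve_eq_ker
  let ψ : Q →ₐ[ℂ] ℂ[X] := Ideal.Quotient.liftₐ (Ideal.span {h.curve}) h.param
    fun f hf => by rw [hker] at hf; exact hf
  have hψinj : Function.Injective ψ := by
    rw [injective_iff_map_eq_zero]
    intro q hq
    obtain ⟨f, rfl⟩ := Ideal.Quotient.mk_surjective q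
    rw [Ideal.Quotient.eq_zero_iff_mem, hker]
    exact hq
  let g : Q →ₐ[ℂ] RatFunc ℂ := (IsScalarTower.toAlgHom ℂ ℂ[X] (RatFunc ℂ)).comp ψ
  have hg : ∀ f, g (Ideal.Quotient.mk _ f) = algebraMap ℂ[X] (RatFunc ℂ) (h.param f) := fun f => rfl
  have hginj : Function.Injective g := (RatFunc.algebraMap_injective ℂ).comp hψinj
  let θ : K →ₐ[ℂ] RatFunc ℂ := IsFractionRing.liftAlgHom (K := K) hginj
  have hθ : ∀ q : Q, θ (algebraMap Q K q) = g q := fun q =>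
    IsFractionRing.lift_algebraMap (K := K) hginj q
  obtain ⟨β, γ, hγ, hβ⟩ := h.exists_param_eq_X_mul
  let z : K := algebraMap Q K (Ideal.Quotient.mk _ β) / algebraMap Q K (Ideal.Quotient.mk _ γ)
  have hθz : θ z = algebraMap ℂ[X] (RatFunc ℂ) X := by
    have hγ' : algebraMap ℂ[X] (RatFunc ℂ) (h.param γ) ≠ 0 :=
      (map_ne_zero_iff _ (RatFunc.algebraMap_injective ℂ)).mpr hγ
    simp only [z]
    rw [map_div₀, hθ, hθ, hg, hg, hβ, map_mul, mul_div_cancel_right₀ _ hγ']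
  have hθaeval : ∀ P : ℂ[X], θ (aeval z P) = algebraMap ℂ[X] (RatFunc ℂ) P := by
    intro P
    rw [← aeval_algHom_apply, hθz, aeval_algebraMap_apply, aeval_X_left_apply]
  refine ⟨z, ?_, ?_⟩
  · intro P R hPR
    apply RatFunc.algebraMap_injective ℂ
    rw [← hθaeval, ← hθaeval, hPR]
  · intro f
    refine ⟨(θ f).num, (θ f).denom, (θ f).denom_ne_zero, θ.injective ?_⟩
    change θ (f * aeval z (θ f).denom) = θ (aeval z (θ f).num)
    have hd : algebraMap ℂ[X] (RatFunc ℂ) (θ f).denom ≠ 0 :=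
      (map_ne_zero_iff _ (RatFunc.algebraMap_injective ℂ)).mpr (θ f).denom_ne_zero
    rw [map_mul, hθaeval, hθaeval, ← eq_div_iff hd, RatFunc.num_div_denom]

theorem Constraints.genus_curve (hc : h.Constraints) [(Ideal.span {h.curve}).IsPrime] :
    genus h.curve = 0 := by
  obtain ⟨z, hz⟩ := hc.exists_isRationalGenerator
  rw [genus, hz.regularDifferentials_eq_bot]
  exact rank_bot _ _

end Params

end SigmaThree

end

theorem mainTheorem8 :
    -- `W₃` lies in the stratum `Σ₃`
    (∀ W ∈ SigmaThree.W3, ∃ V ∈ SigmaThree.stratum 3, W ≤ V) ∧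
    -- the points of `W₃` are the spaces spanned by the polynomials `z^j + H^j_{-2} z² + H^j_0`
    -- with coefficients obeying the constraints, each for exactly one choice of coefficients
    Set.BijOn SigmaThree.Params.space {h | h.Constraints} SigmaThree.W3 ∧
    -- two parameters: `H^3_{-2}` and `H^4_{-2}` are free and determine the rest up to two choices
    (∀ α γ : ℂ,
      {h : SigmaThree.Params | h.Constraints ∧
        h.u SigmaThree.i3 = α ∧ h.u SigmaThree.i4 = γ}.ncard = 1 ∨
      {h : SigmaThree.Params | h.Constraints ∧
        h.u SigmaThree.i3 = α ∧ h.u SigmaThree.i4 = γ}.ncard = 2) ∧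
    ∀ h : SigmaThree.Params, h.Constraints →
      -- infinite-dimensional commutative associative algebra with basis `p_j` and
      -- structure constants `C_{jk}^l`
      LinearIndependent ℂ h.series ∧
      ¬ Module.Finite ℂ h.space ∧
      (∀ j k : SigmaThree.Idx,
        h.series j * h.series k = (h.structConst j k).sum fun l c => c • h.series l) ∧
      (∀ j k : SigmaThree.Idx, h.structConst j k = h.structConst k j) ∧
      (∀ i j k : SigmaThree.Idx,
        ((h.structConst i j).sum fun s c => c • h.structConst s k) =
          (h.structConst j k).sum fun s c => c • h.structConst i s) ∧
      -- the quadrics generate all relations between the `p_j(z)`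
      h.quadricIdeal = RingHom.ker (MvPolynomial.aeval h.poly :
        MvPolynomial SigmaThree.Idx ℂ →ₐ[ℂ] Polynomial ℂ) ∧
      -- the variety defined by the quadrics is the one traced out by the `p_j(z)`
      {x : SigmaThree.Idx → ℂ | ∀ j k : SigmaThree.Idx,
          MvPolynomial.eval x (h.quadric j k) = 0} =
        Set.range (fun (t : ℂ) (j : SigmaThree.Idx) => (h.poly j).eval t) ∧
      -- the ideal contains the plane (3,4) curve, which is irreducible and has genus zero
      MvPolynomial.rename ![SigmaThree.i3, SigmaThree.i4] h.curve ∈ h.quadricIdeal ∧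
      SigmaThree.IsNSCurve 3 4 h.curve ∧
      ∃ _ : (Ideal.span {h.curve}).IsPrime, SigmaThree.genus h.curve = 0 := by
  refine ⟨fun W hW => SigmaThree.exists_stratum_of_mem_W3 hW, SigmaThree.bijOn_space,
    SigmaThree.ncard_constraints, fun h hc => ?_⟩
  have hprime := hc.isPrime_span_curve
  exact ⟨h.linearIndependent_series, h.not_finite_space, hc.series_mul_series,
    h.structConst_comm, hc.structConst_assoc, hc.quadricIdeal_eq_ker, hc.zeroLocus_eq,
    hc.rename_curve_mem, h.isNSCurve_curve, hprime, hc.genus_curve⟩
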